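/- Let $\Bbbk$ be a field of characteristic $0$ and $g\in\mathbb N$. A monic linear pencil of size $d$ is $L_A=I-\sum_{i=1}^g A_ix_i$ with $A_1,\dots,A_g\in M_d(\Bbbk)$; for $X\in M_n(\Bbbk)^g$ put $L_A(X)=I\otimes I-\sum_i A_i\otimes X_i$, and let the free locus of $L_A$ be $$\mathcal Z(L_A)=\bigcup_{n\in\mathbb N}\{X\in M_n(\Bbbk)^g:\det L_A(X)=0\}.$$ Let $\mathcal A\subseteq M_d(\Bbbk)$ be the (possibly non-unital) $\Bbbk$-algebra generated by $A_1,\dots,A_g$, and let $\operatorname{rad}\mathcal A$ be its largest nilpotent ideal. An algebra is simple if its multiplication is not identically zero and it has no two-sided ideals other than $0$ and itself. A free locus is irreducible if it is nonempty and is not a union of two properly smaller free loci. The irreducible components of a free locus are the maximal irreducible free loci contained in it. A pencil is minimal if it has the smallest size among all pencils with the same free locus; a minimal pencil $L_A$ is irreducible if $\mathcal A$ is simple. (i) If $\mathcal A/\operatorname{rad}\mathcal A$ is isomorphic, as a $\Bbbk$-algebra, to a product of $s$ simple algebras ($s\ge 0$), then $\mathcal Z(L_A)$ has exactly $s$ irreducible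 components, and it is their union. (ii) Every irreducible free locus equals $\mathcal Z(L)$ for some irreducible pencil $L$. -/

import Mathlib

open scoped Kronecker

universe u v

/-! ## Ideals, radical and simplicity of a possibly non-unital algebra -/

section NonUnitalAlgebra

variable (k : Type u) {A : Type v} [Field k] [NonUnitalRing A] [Module k A]

variable {k} in
/-- A subspace `I` of a (possibly non-unital) `k`-algebra is a two-sided ideal. -/
structure IsTwoSidedAlgIdeal (I : Submodule k A) : Prop where
  mul_mem_left : ∀ a x : A, x ∈ I → a * x ∈ I
  mul_mem_right : ∀ a x : A, x ∈ I → x * a ∈ I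

variable {k} in
/-- `algIdealPow I m` is the power `I ^ (m + 1)`, that is, the span of all products of
`m + 1` elements of `I`. -/
def algIdealPow (I : Submodule k A) : ℕ → Submodule k A
  | 0 => I
  | m + 1 => Submodule.span k {z : A | ∃ x ∈ algIdealPow I m, ∃ y ∈ I, z = x * y}

variable {k} in
/-- Some positive power of `I` is zero. -/
def IsNilpotentAlgIdeal (I : Submodule k A) : Prop :=
  ∃ m : ℕ, algIdealPow I m = ⊥

variable (A) in
/-- The (nil)radical: the sum of all nilpotent two-sided ideals. In a finite-dimensional
algebra this sum is nilpotent, so it is the largest nilpotent ideal. -/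
def algRad : Submodule k A :=
  sSup {I : Submodule k A | IsTwoSidedAlgIdeal I ∧ IsNilpotentAlgIdeal I}

variable (A) in
/-- A (possibly non-unital) `k`-algebra is simple: its multiplication is not identically zero,
and its only two-sided ideals are `0` and the whole algebra. -/
structure IsSimpleAlg : Prop where
  exists_mul_ne_zero : ∃ a b : A, a * b ≠ 0
  eq_bot_or_eq_top : ∀ I : Submodule k A, IsTwoSidedAlgIdeal I → I = ⊥ ∨ I = ⊤

variable [IsScalarTower k A A] [SMulCommClass k A A]

theorem algRad_isTwoSided : IsTwoSidedAlgIdeal (algRad k A) where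
  mul_mem_left a x hx := by
    have h : algRad k A ≤ (algRad k A).comap (LinearMap.mulLeft k a) := by
      refine sSup_le fun I hI y hy => ?_
      exact (le_sSup hI : I ≤ algRad k A) (hI.1.mul_mem_left a y hy)
    exact h hx
  mul_mem_right a x hx := by
    have h : algRad k A ≤ (algRad k A).comap (LinearMap.mulRight k a) := by
      refine sSup_le fun I hI y hy => ?_
      exact (le_sSup hI : I ≤ algRad k A) (hI.1.mul_mem_right a y hy)
    exact h hx

variable (A) in
/-- The quotient algebra `A / rad A`. -/
abbrev RadQuotient : Type v := A ⧸ algRad k A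

/-- Multiplication of classes, `[a] * [b] = [a * b]`. -/
instance RadQuotient.instMul : Mul (RadQuotient k A) where
  mul := Quotient.map₂ (fun a b => a * b) (by
    intro a a' ha b b' hb
    have ha : a - a' ∈ algRad k A := (Submodule.quotientRel_def _).1 ha
    have hb : b - b' ∈ algRad k A := (Submodule.quotientRel_def _).1 hb
    refine (Submodule.quotientRel_def _).2 ?_
    have h : a * b - a' * b' = (a - a') * b + a' * (b - b') := by
      rw [sub_mul, mul_sub]; abel
    rw [h]
    exact add_mem ((algRad_isTwoSided k).mul_mem_right _ _ ha)
      ((algRad_isTwoSided k).mul_mem_left _ _ hb))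

instance RadQuotient.instNonUnitalRing : NonUnitalRing (RadQuotient k A) :=
  { (inferInstance : AddCommGroup (RadQuotient k A)), RadQuotient.instMul k with
    left_distrib := by
      rintro ⟨a⟩ ⟨b⟩ ⟨c⟩
      exact congrArg Submodule.Quotient.mk (mul_add a b c)
    right_distrib := by
      rintro ⟨a⟩ ⟨b⟩ ⟨c⟩
      exact congrArg Submodule.Quotient.mk (add_mul a b c)
    zero_mul := by
      rintro ⟨a⟩
      exact congrArg Submodule.Quotient.mk (zero_mul a)
    mul_zero := by
      rintro ⟨a⟩
      exact congrArg Submodule.Quotient.mk (mul_zero a)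
    mul_assoc := by
      rintro ⟨a⟩ ⟨b⟩ ⟨c⟩
      exact congrArg Submodule.Quotient.mk (mul_assoc a b c) }

end NonUnitalAlgebra

/-! ## Monic linear pencils and free loci -/

/-- A monic linear pencil `L = I - ∑ i, A i * x i` in `g` noncommuting variables, given by its
size `d` and its coefficients `A i`, which are `d × d` matrices over `k`. -/
structure MonicPencil (k : Type u) (g : ℕ) where
  size : ℕ
  coeff : Fin g → Matrix (Fin size) (Fin size) k

/-- All `g`-tuples of square matrices of the same size `n`, over all `n`. -/
abbrev MatrixTuple (k : Type u) (g : ℕ) : Type u :=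
  Σ n : ℕ, Fin g → Matrix (Fin n) (Fin n) k

namespace MonicPencil

variable {k : Type u} [Field k] {g : ℕ}

/-- The evaluation `L(X) = I ⊗ I - ∑ i, A i ⊗ X i`. -/
def eval (L : MonicPencil k g) {n : ℕ} (X : Fin g → Matrix (Fin n) (Fin n) k) :
    Matrix (Fin L.size × Fin n) (Fin L.size × Fin n) k :=
  (1 : Matrix (Fin L.size) (Fin L.size) k) ⊗ₖ (1 : Matrix (Fin n) (Fin n) k) -
    ∑ i, L.coeff i ⊗ₖ X i

/-- The free locus of `L`. -/
def freeLocus (L : MonicPencil k g) : Set (MatrixTuple k g) :=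
  {X | (L.eval X.2).det = 0}

/-- The `k`-algebra generated by the coefficients of `L`. It need not contain the identity
matrix. -/
def coeffAlgebra (L : MonicPencil k g) :
    NonUnitalSubalgebra k (Matrix (Fin L.size) (Fin L.size) k) :=
  NonUnitalAlgebra.adjoin k (Set.range L.coeff)

/-- `L` has the smallest size among all pencils with the same free locus. -/
def IsMinimal (L : MonicPencil k g) : Prop :=
  ∀ L' : MonicPencil k g, L'.freeLocus = L.freeLocus → L.size ≤ L'.size

/-- An irreducible pencil: a minimal pencil whose coefficients generate a simple algebra. -/
def IsIrreducible (L : MonicPencil k g) : Prop :=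
  L.IsMinimal ∧ IsSimpleAlg k L.coeffAlgebra

end MonicPencil

section FreeLocus

variable {k : Type u} [Field k] {g : ℕ}

/-- `Z` is the free locus of some monic linear pencil. -/
def IsFreeLocus (Z : Set (MatrixTuple k g)) : Prop :=
  ∃ L : MonicPencil k g, L.freeLocus = Z

/-- An irreducible free locus: nonempty and not a union of two smaller free loci. -/
def IsIrreducibleFreeLocus (Z : Set (MatrixTuple k g)) : Prop :=
  IsFreeLocus Z ∧ Z.Nonempty ∧
    ¬ ∃ Z₁ Z₂ : Set (MatrixTuple k g),
      IsFreeLocus Z₁ ∧ IsFreeLocus Z₂ ∧ Z₁ ⊂ Z ∧ Z₂ ⊂ Z ∧ Z = Z₁ ∪ Z₂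

/-- The irreducible components of `Z`: the maximal irreducible free loci contained in `Z`. -/
def freeLocusComponents (Z : Set (MatrixTuple k g)) : Set (Set (MatrixTuple k g)) :=
  {W | Maximal (fun V => IsIrreducibleFreeLocus V ∧ V ⊆ Z) W}

end FreeLocus

/-! Exchange the roles of `A` and `X`. A tuple `X` gives the matrix `T = 1 - ∑ X i ⊗ x i` over the
free algebra `F`, and `det L_A(X) ≠ 0` says that `T` becomes invertible after evaluation at `A`.
This depends only on the kernel `K` of evaluation: it means that `T` is right invertible modulo `K`
(`freeLocus_eq_locus`). Free loci are thus the loci of two-sided ideals of finite codimension in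
`F`.

If `K` lies in `I` and `J` and contains their product, then `locus K` is the union of `locus I` and
`locus J` (`locus_eq_union`). Prime ideals of finite codimension are maximal, so `locus K` is the
union of the loci of the maximal ideals above `K` (`locus_eq_sUnion`). The augmentation ideal
contributes nothing, because `T = 1` modulo it; the other maximal ideals of finite codimension are
the point ideals.

Conversely, loci detect ideals: for a point ideal `P`, `locus P ⊆ locus K` forces `K ≤ P`
(`IsPointIdeal.locus_subset_iff`). Otherwise some `f` in `K` without constant term is `1` modulo
`P`. A realization `f = C (1 - N)⁻¹ b` makes `1 - N - b C` a generic pencil whose invertibility is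
governed by `1 - f`, so it is regular modulo `K` but not modulo `P`. Hence irreducible free loci
correspond to point ideals, and the components of `locus K` to the point ideals above `K`.

For `K` the kernel of evaluation at `A`, these correspond to the maximal ideals of the coefficient
algebra with nonzero multiplication on the quotient (`encard_isPointIdeal`), which are the kernels
of the projections to the simple factors modulo the radical (`encard_isRegularMaximal`). For (ii), a
minimal pencil of an irreducible locus acts without invariant subspaces, so its kernel is a point
ideal and its coefficient algebra is simple. -/

/-! ## Prime and maximal two-sided ideals of finite codimension -/

section TwoSidedIdeals

/-- A two-sided ideal of an Artinian prime ring is trivial. -/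
theorem Ideal.eq_bot_or_eq_top_of_isArtinian_of_prime {E : Type*} [Ring E] [IsArtinianRing E]
    (hp : ∀ x y : E, (∀ e, x * e * y = 0) → x = 0 ∨ y = 0) (I : Ideal E) [I.IsTwoSided] :
    I = ⊥ ∨ I = ⊤ := by
  rcases subsingleton_or_nontrivial E with hE | hE
  · exact Or.inl (Subsingleton.elim _ _)
  -- The radical `J` is nilpotent. If `J ≠ 0`, primeness lowers the exponent from `J ^ (n + 1) = 0`
  -- to `J ^ n = 0`, down to the absurd `J ^ 0 = 0`.
  have hJ : Ring.jacobson E = ⊥ := by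
    obtain ⟨n, hn⟩ := IsSemiprimaryRing.isNilpotent (R := E)
    induction n with
    | zero =>
      rw [Submodule.pow_zero, Ideal.one_eq_top] at hn
      exact absurd hn top_ne_bot
    | succ n ih =>
      by_contra hne
      apply hne
      apply ih
      obtain ⟨y, hy, hy0⟩ := Submodule.exists_mem_ne_zero_of_ne_bot hne
      rw [Submodule.zero_eq_bot, eq_bot_iff]
      intro x hx
      refine (hp x y fun e => ?_).resolve_right hy0
      have : x * (e * y) ∈ Ring.jacobson E ^ (n + 1) := by
        rw [Submodule.pow_succ]
        exact Ideal.mul_mem_mul hx (Ideal.mul_mem_left _ e hy)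
      rw [hn] at this
      rw [mul_assoc]
      exact this
  have : IsSemisimpleRing E := IsArtinianRing.isSemisimpleRing_iff_jacobson.2 hJ
  -- By semisimplicity `I` has a complementary left ideal `C`. Since `I E C ⊆ I ∩ C = 0` and `I ≠
  -- 0`, primeness gives `C = 0`.
  obtain ⟨C, hC⟩ := exists_isCompl I
  by_cases hI : I = ⊥
  · exact Or.inl hI
  obtain ⟨x, hx, hx0⟩ := Submodule.exists_mem_ne_zero_of_ne_bot hI
  right
  have hCbot : C = ⊥ := by
    rw [eq_bot_iff]
    intro y hy
    refine (hp x y fun e => ?_).resolve_left hx0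
    have h1 : x * e * y ∈ I := Ideal.mul_mem_right _ _ (Ideal.mul_mem_right _ _ hx)
    have h2 : x * e * y ∈ C := Ideal.mul_mem_left _ _ hy
    exact (Submodule.disjoint_def.1 hC.disjoint) _ h1 h2
  have := hC.sup_eq_top
  rwa [hCbot, sup_bot_eq] at this

namespace TwoSidedIdeal

variable {R : Type u} [Ring R]

/-- A two-sided ideal is prime if it contains a product of ideals only when it contains one of
the factors. -/
def IsPrimeIdeal (P : TwoSidedIdeal R) : Prop :=
  ∀ I J : TwoSidedIdeal R, (∀ a ∈ I, ∀ b ∈ J, a * b ∈ P) → I ≤ P ∨ J ≤ P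

theorem exists_add_eq_one_of_isCoatom {P I : TwoSidedIdeal R} (hP : IsCoatom P) (hI : ¬ I ≤ P) :
    ∃ a ∈ I, ∃ b ∈ P, a + b = 1 := by
  have h : I ⊔ P = ⊤ := hP.2 _ (lt_of_le_of_ne le_sup_right fun h => hI (h ▸ le_sup_left))
  exact mem_sup.1 (h ▸ mem_top R : (1 : R) ∈ I ⊔ P)

theorem isPrimeIdeal_of_isCoatom {P : TwoSidedIdeal R} (hP : IsCoatom P) : P.IsPrimeIdeal := by
  intro I J h
  by_contra! hc
  obtain ⟨a, ha, p, hp, hap⟩ := exists_add_eq_one_of_isCoatom hP hc.1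
  obtain ⟨b, hb, q, hq, hbq⟩ := exists_add_eq_one_of_isCoatom hP hc.2
  refine hP.1 ((one_mem_iff P).1 ?_)
  have : (1 : R) = a * b + (a * q + p) := by
    calc (1 : R) = a * 1 + p := by rw [mul_one, hap]
      _ = a * b + (a * q + p) := by rw [← hbq, mul_add, add_assoc]
  rw [this]
  exact P.add_mem (h a ha b hb) (P.add_mem (P.mul_mem_left _ _ hq) hp)

theorem IsPrimeIdeal.mem_or_mem {P : TwoSidedIdeal R} (hP : P.IsPrimeIdeal) {x y : R}
    (h : ∀ r, x * r * y ∈ P) : x ∈ P ∨ y ∈ P := by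
  have key : ∀ r, ∀ b ∈ span {y}, x * r * b ∈ P := by
    intro r b hb
    induction hb using span_induction generalizing r with
    | mem b hb => rw [Set.mem_singleton_iff.1 hb]; exact h r
    | zero => simp
    | add b c _ _ hb hc => rw [mul_add]; exact P.add_mem (hb r) (hc r)
    | neg b _ hb => rw [mul_neg]; exact P.neg_mem (hb r)
    | left_absorb a b _ hb => rw [← mul_assoc, mul_assoc x]; exact hb _
    | right_absorb a b _ hb => rw [← mul_assoc]; exact P.mul_mem_right _ _ (hb r)
  have key' : ∀ a ∈ span {x}, ∀ b ∈ span {y}, a * b ∈ P := by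
    intro a ha
    induction ha using span_induction with
    | mem a ha =>
      intro b hb
      rw [Set.mem_singleton_iff.1 ha]
      simpa using key 1 b hb
    | zero => intro b _; simp
    | add a c _ _ ha hc => intro b hb; rw [add_mul]; exact P.add_mem (ha b hb) (hc b hb)
    | neg a _ ha => intro b hb; rw [neg_mul]; exact P.neg_mem (ha b hb)
    | left_absorb a c _ hc => intro b hb; rw [mul_assoc]; exact P.mul_mem_left _ _ (hc b hb)
    | right_absorb a c _ hc =>
      intro b hb; rw [mul_assoc]; exact hc _ ((span {y}).mul_mem_left _ _ hb)
  rcases hP _ _ key' with h | h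
  · exact Or.inl (h (subset_span rfl))
  · exact Or.inr (h (subset_span rfl))

variable (k : Type u) [Field k] [Algebra k R]

/-- A two-sided ideal of finite codimension. -/
def Cofinite (K : TwoSidedIdeal R) : Prop := FiniteDimensional k (R ⧸ K.asIdeal)

variable {k}

theorem Cofinite.mono {K K' : TwoSidedIdeal R} (hK : K.Cofinite k) (h : K ≤ K') :
    K'.Cofinite k := by
  have : FiniteDimensional k (R ⧸ K.asIdeal) := hK
  have h' : K.asIdeal ≤ K'.asIdeal := h
  exact Module.Finite.of_surjective (Ideal.Quotient.factorₐ k h').toLinearMap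
    (Ideal.Quotient.factor_surjective h')

theorem Cofinite.finrank_lt {K K' : TwoSidedIdeal R} (hK : K.Cofinite k) (h : K < K') :
    Module.finrank k (R ⧸ K'.asIdeal) < Module.finrank k (R ⧸ K.asIdeal) := by
  have : FiniteDimensional k (R ⧸ K.asIdeal) := hK
  have h' : K.asIdeal ≤ K'.asIdeal := h.le
  obtain ⟨x, hx', hx⟩ := Set.exists_of_ssubset ((lt_iff _ _).1 h)
  let f := (Ideal.Quotient.factorₐ k h').toLinearMap
  have hf : Function.Surjective f := Ideal.Quotient.factor_surjective h'
  have hr := f.finrank_range_add_finrank_ker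
  rw [LinearMap.range_eq_top.2 hf, finrank_top] at hr
  have hpos : 0 < Module.finrank k (LinearMap.ker f) := by
    have : Nontrivial (LinearMap.ker f) := by
      refine ⟨⟨⟨Ideal.Quotient.mk _ x, ?_⟩, 0, ?_⟩⟩
      · change Ideal.Quotient.mk K'.asIdeal x = 0
        exact Ideal.Quotient.eq_zero_iff_mem.2 hx'
      · intro h0
        exact hx (Ideal.Quotient.eq_zero_iff_mem.1 (congrArg Subtype.val h0))
    exact Module.finrank_pos
  omega

/-- The quotient is a finite-dimensional, hence Artinian, prime ring, so it has no proper nonzero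
two-sided ideals. -/
theorem Cofinite.isCoatom_of_isPrimeIdeal {P : TwoSidedIdeal R} (hf : P.Cofinite k)
    (hP : P.IsPrimeIdeal) (hne : P ≠ ⊤) : IsCoatom P := by
  have : FiniteDimensional k (R ⧸ P.asIdeal) := hf
  have : IsArtinianRing (R ⧸ P.asIdeal) := IsArtinianRing.of_finite k _
  refine ⟨hne, fun Q hQ => ?_⟩
  let f := Ideal.Quotient.mk P.asIdeal
  have hs : Function.Surjective f := Ideal.Quotient.mk_surjective
  have hmem : ∀ y, y ∈ Q.asIdeal.map f ↔ ∃ x ∈ Q, f x = y := fun y =>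
    Ideal.mem_map_iff_of_surjective f hs
  have : (Q.asIdeal.map f).IsTwoSided := ⟨by
    intro a b ha
    obtain ⟨x, hx, rfl⟩ := (hmem _).1 ha
    obtain ⟨b, rfl⟩ := hs b
    exact (hmem _).2 ⟨x * b, Q.mul_mem_right _ _ hx, map_mul f x b⟩⟩
  have := Ideal.eq_bot_or_eq_top_of_isArtinian_of_prime (E := R ⧸ P.asIdeal) (by
    intro x y h
    obtain ⟨x, rfl⟩ := hs x
    obtain ⟨y, rfl⟩ := hs y
    have := hP.mem_or_mem (x := x) (y := y) fun r => by
      have := h (f r)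
      rw [← map_mul, ← map_mul] at this
      exact Ideal.Quotient.eq_zero_iff_mem.1 this
    exact this.imp (fun h => Ideal.Quotient.eq_zero_iff_mem.2 h)
      (fun h => Ideal.Quotient.eq_zero_iff_mem.2 h)) (Q.asIdeal.map f)
  rcases this with h | h
  · exfalso
    apply hQ.not_ge
    intro x hx
    have : f x ∈ Q.asIdeal.map f := (hmem _).2 ⟨x, hx, rfl⟩
    rw [h] at this
    exact Ideal.Quotient.eq_zero_iff_mem.1 this
  · rw [← one_mem_iff]
    obtain ⟨x, hx, hx1⟩ := (hmem 1).1 (h ▸ Submodule.mem_top)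
    have : 1 - x ∈ P := by
      have h0 : f (1 - x) = 0 := by rw [map_sub, map_one, hx1, sub_self]
      exact Ideal.Quotient.eq_zero_iff_mem.1 h0
    have := Q.add_mem (hQ.le this) hx
    rwa [sub_add_cancel] at this

/-- Induction over the two-sided ideals of finite codimension: it suffices to treat the unit
ideal, the maximal ideals, and ideals containing a product of two larger ones. -/
theorem Cofinite.induction {C : TwoSidedIdeal R → Prop} (top : C ⊤)
    (coatom : ∀ P : TwoSidedIdeal R, P.Cofinite k → IsCoatom P → C P)
    (mul : ∀ K I J : TwoSidedIdeal R, K ≤ I → K ≤ J → (∀ a ∈ I, ∀ b ∈ J, a * b ∈ K) →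
      C I → C J → C K)
    (K : TwoSidedIdeal R) (hK : K.Cofinite k) : C K := by
  induction hn : Module.finrank k (R ⧸ K.asIdeal) using Nat.strong_induction_on
    generalizing K with
  | _ n ih =>
    subst hn
    by_cases htop : K = ⊤
    · exact htop ▸ top
    by_cases hprime : K.IsPrimeIdeal
    · exact coatom K hK (hK.isCoatom_of_isPrimeIdeal hprime htop)
    unfold IsPrimeIdeal at hprime
    push Not at hprime
    obtain ⟨I, J, hIJ, hI, hJ⟩ := hprime
    -- Adding `K` to the two factors keeps their product inside `K` and makes both strictly larger
    -- than `K`, so their codimensions drop.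
    refine mul K (I ⊔ K) (J ⊔ K) le_sup_right le_sup_right ?_ ?_ ?_
    · intro a ha b hb
      obtain ⟨i, hi, p, hp, rfl⟩ := mem_sup.1 ha
      obtain ⟨j, hj, q, hq, rfl⟩ := mem_sup.1 hb
      rw [add_mul, mul_add]
      exact K.add_mem (K.add_mem (hIJ _ hi _ hj) (K.mul_mem_left _ _ hq)) (K.mul_mem_right _ _ hp)
    · have : K < I ⊔ K := lt_of_le_of_ne le_sup_right fun h => hI (h ▸ le_sup_left)
      exact ih _ (hK.finrank_lt this) _ (hK.mono this.le) rfl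
    · have : K < J ⊔ K := lt_of_le_of_ne le_sup_right fun h => hJ (h ▸ le_sup_left)
      exact ih _ (hK.finrank_lt this) _ (hK.mono this.le) rfl

end TwoSidedIdeal

end TwoSidedIdeals

/-! ## Regularity of a matrix tuple modulo an ideal of the free algebra -/

section MatrixIdeal

variable {R : Type u} [Ring R] {m n p : Type*}

/-- All entries of `M` lie in `K`. -/
def TwoSidedIdeal.MatMem (K : TwoSidedIdeal R) (M : Matrix m n R) : Prop := ∀ i j, M i j ∈ K

namespace TwoSidedIdeal.MatMem

variable {K : TwoSidedIdeal R}

theorem mul_left [Fintype n] (A : Matrix m n R) {M : Matrix n p R} (h : K.MatMem M) :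
    K.MatMem (A * M) := fun i j => by
  rw [Matrix.mul_apply]
  exact sum_mem fun l _ => K.mul_mem_left _ _ (h l j)

theorem mul_right [Fintype n] {M : Matrix m n R} (h : K.MatMem M) (A : Matrix n p R) :
    K.MatMem (M * A) := fun i j => by
  rw [Matrix.mul_apply]
  exact sum_mem fun l _ => K.mul_mem_right _ _ (h i l)

theorem add {M N : Matrix m n R} (hM : K.MatMem M) (hN : K.MatMem N) : K.MatMem (M + N) :=
  fun i j => K.add_mem (hM i j) (hN i j)

theorem sub {M N : Matrix m n R} (hM : K.MatMem M) (hN : K.MatMem N) : K.MatMem (M - N) :=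
  fun i j => K.sub_mem (hM i j) (hN i j)

theorem neg {M : Matrix m n R} (hM : K.MatMem M) : K.MatMem (-M) :=
  fun i j => K.neg_mem (hM i j)

end TwoSidedIdeal.MatMem

end MatrixIdeal

namespace FreeLocus

variable {k : Type u} [Field k] {g : ℕ}

/-- The generic pencil `1 - ∑ i, x i ⊗ X i` as a matrix over the free algebra. -/
noncomputable def genericPencil {n : ℕ} (X : Fin g → Matrix (Fin n) (Fin n) k) :
    Matrix (Fin n) (Fin n) (FreeAlgebra k (Fin g)) :=
  1 - ∑ i, (X i).map fun c => c • FreeAlgebra.ι k i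

/-- The matrix tuple `X` is regular modulo `K` if the generic pencil at `X` is (right) invertible
modulo `K`. -/
def IsRegular (K : TwoSidedIdeal (FreeAlgebra k (Fin g))) (X : MatrixTuple k g) : Prop :=
  ∃ U, K.MatMem (genericPencil X.2 * U - 1)

theorem IsRegular.mono {K K' : TwoSidedIdeal (FreeAlgebra k (Fin g))} (h : K ≤ K')
    {X : MatrixTuple k g} : IsRegular K X → IsRegular K' X :=
  fun ⟨U, hU⟩ => ⟨U, fun i j => h (hU i j)⟩

/-- With `W = U + V - U T V` one has `1 - T W = (1 - T U)(1 - T V)`: the defects of two right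
inverses multiply. -/
theorem IsRegular.of_mul {K I J : TwoSidedIdeal (FreeAlgebra k (Fin g))}
    (h : ∀ a ∈ I, ∀ b ∈ J, a * b ∈ K) {X : MatrixTuple k g} (hI : IsRegular I X)
    (hJ : IsRegular J X) : IsRegular K X := by
  obtain ⟨U, hU⟩ := hI
  obtain ⟨V, hV⟩ := hJ
  refine ⟨U + V - U * (genericPencil X.2 * V), ?_⟩
  have : genericPencil X.2 * (U + V - U * (genericPencil X.2 * V)) - 1 =
      -((genericPencil X.2 * U - 1) * (genericPencil X.2 * V - 1)) := by noncomm_ring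
  rw [this]
  refine TwoSidedIdeal.MatMem.neg fun i j => ?_
  rw [Matrix.mul_apply]
  exact sum_mem fun l _ => h _ (hU i l) _ (hV l j)

theorem isRegular_top (X : MatrixTuple k g) :
    IsRegular (⊤ : TwoSidedIdeal (FreeAlgebra k (Fin g))) X :=
  ⟨0, fun _ _ => TwoSidedIdeal.mem_top _⟩

variable (k g) in
/-- The augmentation ideal: noncommutative polynomials without constant term. -/
noncomputable def augIdeal : TwoSidedIdeal (FreeAlgebra k (Fin g)) :=
  TwoSidedIdeal.ker (FreeAlgebra.algebraMapInv (R := k) (X := Fin g))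

theorem mem_augIdeal {r : FreeAlgebra k (Fin g)} :
    r ∈ augIdeal k g ↔ FreeAlgebra.algebraMapInv r = 0 := TwoSidedIdeal.mem_ker _

theorem ι_mem_augIdeal (i : Fin g) : FreeAlgebra.ι k i ∈ augIdeal k g := by
  simp [mem_augIdeal, FreeAlgebra.algebraMapInv]

theorem smul_mem_augIdeal (c : k) {r : FreeAlgebra k (Fin g)} (hr : r ∈ augIdeal k g) :
    c • r ∈ augIdeal k g := by
  rw [Algebra.smul_def]
  exact (augIdeal k g).mul_mem_left _ _ hr

theorem isRegular_augIdeal (X : MatrixTuple k g) : IsRegular (augIdeal k g) X := by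
  refine ⟨1, fun r s => ?_⟩
  rw [mul_one, genericPencil, sub_sub_cancel_left, Matrix.neg_apply, Matrix.sum_apply]
  exact (augIdeal k g).neg_mem (sum_mem fun i _ => smul_mem_augIdeal _ (ι_mem_augIdeal i))

/-- Evaluating a polynomial differs from its value at a constant by an element of the nonunital
algebra generated by the evaluation point. -/
theorem lift_sub_algebraMap_mem_adjoin {A : Type*} [Ring A] [Algebra k A] (a : Fin g → A)
    (r : FreeAlgebra k (Fin g)) :
    FreeAlgebra.lift k a r - algebraMap k A (FreeAlgebra.algebraMapInv r) ∈
      NonUnitalAlgebra.adjoin k (Set.range a) := by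
  induction r using FreeAlgebra.induction with
  | grade0 c => simp
  | grade1 i =>
    simpa [FreeAlgebra.algebraMapInv] using
      NonUnitalAlgebra.subset_adjoin k (Set.mem_range_self i)
  | add x y hx hy =>
    simp only [map_add]
    rw [add_sub_add_comm]
    exact add_mem hx hy
  | mul x y hx hy =>
    set c := FreeAlgebra.algebraMapInv (R := k) x with hc
    set d := FreeAlgebra.algebraMapInv (R := k) y with hd
    have : FreeAlgebra.lift k a (x * y) -
        algebraMap k A (FreeAlgebra.algebraMapInv (x * y)) =
        (FreeAlgebra.lift k a x - algebraMap k A c) * (FreeAlgebra.lift k a y - algebraMap k A d) +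
        c • (FreeAlgebra.lift k a y - algebraMap k A d) +
        d • (FreeAlgebra.lift k a x - algebraMap k A c) := by
      rw [map_mul, map_mul, ← hc, ← hd, map_mul, Algebra.smul_def, Algebra.smul_def,
        Algebra.commutes d (_ - _)]
      noncomm_ring
    rw [this]
    exact add_mem (add_mem (mul_mem hx hy) (SMulMemClass.smul_mem _ hy))
      (SMulMemClass.smul_mem _ hx)

theorem lift_mem_adjoin {A : Type*} [Ring A] [Algebra k A] (a : Fin g → A)
    {r : FreeAlgebra k (Fin g)} (hr : r ∈ augIdeal k g) :
    FreeAlgebra.lift k a r ∈ NonUnitalAlgebra.adjoin k (Set.range a) := by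
  have := lift_sub_algebraMap_mem_adjoin a r
  rwa [mem_augIdeal.1 hr, map_zero, sub_zero] at this

theorem exists_lift_eq_of_mem_adjoin {A : Type*} [Ring A] [Algebra k A] (a : Fin g → A)
    {x : A} (hx : x ∈ NonUnitalAlgebra.adjoin k (Set.range a)) :
    ∃ r ∈ augIdeal k g, FreeAlgebra.lift k a r = x := by
  induction hx using NonUnitalAlgebra.adjoin_induction with
  | mem x hx =>
    obtain ⟨i, rfl⟩ := hx
    exact ⟨_, ι_mem_augIdeal i, FreeAlgebra.lift_ι_apply _ _⟩
  | add x y _ _ hx hy =>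
    obtain ⟨r, hr, rfl⟩ := hx
    obtain ⟨s, hs, rfl⟩ := hy
    exact ⟨r + s, (augIdeal k g).add_mem hr hs, map_add _ _ _⟩
  | zero => exact ⟨0, (augIdeal k g).zero_mem, map_zero _⟩
  | mul x y _ _ hx hy =>
    obtain ⟨r, hr, rfl⟩ := hx
    obtain ⟨s, hs, rfl⟩ := hy
    exact ⟨r * s, (augIdeal k g).mul_mem_right _ _ hr, map_mul _ _ _⟩
  | smul c x _ hx =>
    obtain ⟨r, hr, rfl⟩ := hx
    exact ⟨c • r, smul_mem_augIdeal c hr, map_smul _ _ _⟩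

/-! ## Realization of polynomials without constant term -/

/-- A realization `f = C (1 - N)⁻¹ b` with scalar `C` and homogeneous linear `N` and `b`. -/
structure Realization (f : FreeAlgebra k (Fin g)) (m : Type) [Fintype m] [DecidableEq m] where
  N : Matrix m m (FreeAlgebra k (Fin g))
  U : Matrix m m (FreeAlgebra k (Fin g))
  b : Matrix m Unit (FreeAlgebra k (Fin g))
  C : Matrix Unit m k
  hN : ∀ i j, N i j ∈ Submodule.span k (Set.range (FreeAlgebra.ι k (X := Fin g)))
  hb : ∀ i j, b i j ∈ Submodule.span k (Set.range (FreeAlgebra.ι k (X := Fin g)))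
  mul_U : (1 - N) * U = 1
  U_mul : U * (1 - N) = 1
  eq : C.map (algebraMap k (FreeAlgebra k (Fin g))) * (U * b) = Matrix.of fun _ _ => f

/-- `f` has some realization. -/
def IsRealizable (f : FreeAlgebra k (Fin g)) : Prop :=
  ∃ (m : Type) (_ : Fintype m) (_ : DecidableEq m), Nonempty (Realization f m)

theorem one_sub_fromBlocks {m n : Type*} [DecidableEq m] [DecidableEq n] {R : Type*} [Ring R]
    (A : Matrix m m R) (B : Matrix m n R) (D : Matrix n n R) :
    1 - Matrix.fromBlocks A B 0 D = Matrix.fromBlocks (1 - A) (-B) 0 (1 - D) := by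
  rw [← Matrix.fromBlocks_one, sub_eq_add_neg, Matrix.fromBlocks_neg, Matrix.fromBlocks_add]
  simp only [sub_eq_add_neg, zero_add, neg_zero]

theorem mem_span_of_scalar_mul {m n : Type*} {V : Submodule k (FreeAlgebra k (Fin g))}
    {b : Matrix m Unit (FreeAlgebra k (Fin g))} (hb : ∀ i j, b i j ∈ V) (C : Matrix Unit n k)
    (i : m) (j : n) : (b * C.map (algebraMap k (FreeAlgebra k (Fin g)))) i j ∈ V := by
  rw [Matrix.mul_apply]
  refine sum_mem fun l _ => ?_
  rw [Matrix.map_apply, ← Algebra.commutes, ← Algebra.smul_def]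
  exact V.smul_mem _ (hb _ _)

theorem isRealizable_ι (i : Fin g) : IsRealizable (FreeAlgebra.ι k i) :=
  ⟨Unit, inferInstance, inferInstance, ⟨{
    N := 0
    U := 1
    b := Matrix.of fun _ _ => FreeAlgebra.ι k i
    C := 1
    hN := fun _ _ => Submodule.zero_mem _
    hb := fun _ _ => Submodule.subset_span (Set.mem_range_self i)
    mul_U := by simp
    U_mul := by simp
    eq := by simp }⟩⟩

theorem isRealizable_zero : IsRealizable (0 : FreeAlgebra k (Fin g)) :=
  ⟨Unit, inferInstance, inferInstance, ⟨{
    N := 0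
    U := 1
    b := 0
    C := 0
    hN := fun _ _ => Submodule.zero_mem _
    hb := fun _ _ => Submodule.zero_mem _
    mul_U := by simp
    U_mul := by simp
    eq := by ext; simp }⟩⟩

theorem IsRealizable.smul (c : k) {f : FreeAlgebra k (Fin g)} (hf : IsRealizable f) :
    IsRealizable (c • f) := by
  obtain ⟨m, _, _, ⟨F⟩⟩ := hf
  refine ⟨m, inferInstance, inferInstance, ⟨{ F with C := c • F.C, eq := ?_ }⟩⟩
  have : (c • F.C).map (algebraMap k (FreeAlgebra k (Fin g))) =
      c • F.C.map (algebraMap k (FreeAlgebra k (Fin g))) := by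
    ext i j
    simp [Algebra.smul_def]
  rw [this, Matrix.smul_mul, F.eq]
  rfl

theorem IsRealizable.add {f h : FreeAlgebra k (Fin g)} (hf : IsRealizable f)
    (hh : IsRealizable h) : IsRealizable (f + h) := by
  obtain ⟨m, _, _, ⟨F⟩⟩ := hf
  obtain ⟨n, _, _, ⟨H⟩⟩ := hh
  refine ⟨m ⊕ n, inferInstance, inferInstance, ⟨{
    N := Matrix.fromBlocks F.N 0 0 H.N
    U := Matrix.fromBlocks F.U 0 0 H.U
    b := Matrix.fromRows F.b H.b
    C := Matrix.fromCols F.C H.C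
    hN := ?_
    hb := ?_
    mul_U := ?_
    U_mul := ?_
    eq := ?_ }⟩⟩
  · rintro (i | i) (j | j)
    · exact F.hN i j
    · exact Submodule.zero_mem _
    · exact Submodule.zero_mem _
    · exact H.hN i j
  · rintro (i | i) j
    · exact F.hb i j
    · exact H.hb i j
  · rw [one_sub_fromBlocks, Matrix.fromBlocks_multiply]
    simp [F.mul_U, H.mul_U]
  · rw [one_sub_fromBlocks, Matrix.fromBlocks_multiply]
    simp [F.U_mul, H.U_mul]
  · rw [Matrix.fromCols_map, Matrix.fromBlocks_mul_fromRows, Matrix.fromCols_mul_fromRows]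
    simp only [Matrix.zero_mul, add_zero, zero_add, F.eq, H.eq]
    rfl

theorem IsRealizable.mul {f h : FreeAlgebra k (Fin g)} (hf : IsRealizable f)
    (hh : IsRealizable h) : IsRealizable (f * h) := by
  obtain ⟨m, _, _, ⟨F⟩⟩ := hf
  obtain ⟨n, _, _, ⟨H⟩⟩ := hh
  let D := H.C.map (algebraMap k (FreeAlgebra k (Fin g)))
  refine ⟨m ⊕ n, inferInstance, inferInstance, ⟨{
    N := Matrix.fromBlocks F.N (F.b * D) 0 H.N
    -- The inverse of the block triangular matrix `1 - N`. Its corner carries the output of the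
    -- realization of `h` into the input of that of `f`.
    U := Matrix.fromBlocks F.U (F.U * (F.b * D) * H.U) 0 H.U
    b := Matrix.fromRows 0 H.b
    C := Matrix.fromCols F.C 0
    hN := ?_
    hb := ?_
    mul_U := ?_
    U_mul := ?_
    eq := ?_ }⟩⟩
  · rintro (i | i) (j | j)
    · exact F.hN i j
    · exact mem_span_of_scalar_mul F.hb H.C i j
    · exact Submodule.zero_mem _
    · exact H.hN i j
  · rintro (i | i) j
    · exact Submodule.zero_mem _
    · exact H.hb i j
  · rw [one_sub_fromBlocks, Matrix.fromBlocks_multiply]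
    simp [F.mul_U, H.mul_U, ← Matrix.mul_assoc]
  · rw [one_sub_fromBlocks, Matrix.fromBlocks_multiply]
    simp [F.U_mul, H.U_mul, Matrix.mul_assoc]
  · rw [Matrix.fromCols_map, Matrix.fromBlocks_mul_fromRows, Matrix.fromCols_mul_fromRows]
    have : F.C.map (algebraMap k (FreeAlgebra k (Fin g))) * (F.U * (F.b * D) * H.U * H.b) =
        (F.C.map (algebraMap k (FreeAlgebra k (Fin g))) * (F.U * F.b)) * (D * (H.U * H.b)) := by
      simp only [Matrix.mul_assoc]
    simp only [Matrix.mul_zero, zero_add, this, F.eq, H.eq, D, Matrix.zero_mul, add_zero,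
      Matrix.map_zero _ (map_zero (algebraMap k (FreeAlgebra k (Fin g))))]
    ext
    simp [Matrix.mul_apply]

/-- The augmentation ideal is the nonunital algebra generated by the variables, and realizable
polynomials include the variables and are closed under the algebra operations. -/
theorem isRealizable_of_mem_augIdeal {f : FreeAlgebra k (Fin g)} (hf : f ∈ augIdeal k g) :
    IsRealizable f := by
  have h := lift_mem_adjoin (FreeAlgebra.ι k (X := Fin g)) hf
  have hid : FreeAlgebra.lift k (FreeAlgebra.ι k (X := Fin g)) = AlgHom.id k _ := by
    ext i
    simp
  rw [hid, AlgHom.id_apply] at h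
  clear hf
  induction h using NonUnitalAlgebra.adjoin_induction with
  | mem x hx => obtain ⟨i, rfl⟩ := hx; exact isRealizable_ι i
  | add x y _ _ hx hy => exact hx.add hy
  | zero => exact isRealizable_zero
  | mul x y _ _ hx hy => exact hx.mul hy
  | smul c x _ hx => exact hx.smul c

theorem exists_genericPencil_eq {m : Type} [Fintype m] [DecidableEq m]
    (M : Matrix m m (FreeAlgebra k (Fin g)))
    (hM : ∀ i j, M i j ∈ Submodule.span k (Set.range (FreeAlgebra.ι k (X := Fin g)))) :
    ∃ (n : ℕ) (e : m ≃ Fin n) (X : Fin g → Matrix (Fin n) (Fin n) k),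
      (1 - M) = (genericPencil X).submatrix e e := by
  simp only [Submodule.mem_span_range_iff_exists_fun] at hM
  choose c hc using hM
  let e := Fintype.equivFin m
  refine ⟨_, e, fun i => Matrix.of fun r s => c (e.symm r) (e.symm s) i, ?_⟩
  ext r s
  simp [genericPencil, Matrix.sum_apply, Matrix.one_apply, hc]

/-- For every polynomial `f` without constant term there is a matrix tuple which is regular modulo
an ideal containing `f` and is not regular modulo a proper ideal containing `1 - f`. -/
theorem exists_isRegular_and_not_isRegular {f : FreeAlgebra k (Fin g)} (hf : f ∈ augIdeal k g) :
    ∃ X : MatrixTuple k g,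
      (∀ K : TwoSidedIdeal (FreeAlgebra k (Fin g)), f ∈ K → IsRegular K X) ∧
      ∀ K : TwoSidedIdeal (FreeAlgebra k (Fin g)), K ≠ ⊤ → 1 - f ∈ K → ¬ IsRegular K X := by
  obtain ⟨m, _, _, ⟨F⟩⟩ := isRealizable_of_mem_augIdeal hf
  let D := F.C.map (algebraMap k (FreeAlgebra k (Fin g)))
  -- With `E = U b D`, the pencil `1 - N - b D` factors as `(1 - N)(1 - E)`, and `D U b = f`.
  obtain ⟨n, e, X, hX⟩ := exists_genericPencil_eq (F.N + F.b * D) fun i j =>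
    Submodule.add_mem _ (F.hN i j) (mem_span_of_scalar_mul F.hb F.C i j)
  set T := genericPencil X with hT
  have hT1 : F.U * T.submatrix e e = 1 - F.U * F.b * D := by
    rw [← hX, ← sub_sub, Matrix.mul_sub, F.U_mul, Matrix.mul_assoc]
  have hT2 : T.submatrix e e = (1 - F.N) * (1 - F.U * F.b * D) := by
    rw [← hT1, ← Matrix.mul_assoc, F.mul_U, Matrix.one_mul]
  have hD : D * (F.U * F.b) = Matrix.of fun _ _ => f := F.eq
  refine ⟨⟨n, X⟩, fun K hK => ?_, fun K hK hfK => ?_⟩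
  -- Modulo `K`, `E ^ 2 = U b f D` vanishes, so `1 + E` inverts `1 - E`.
  · refine ⟨((1 + F.U * F.b * D) * F.U).submatrix e.symm e.symm, ?_⟩
    have h1 : T.submatrix e e * ((1 + F.U * F.b * D) * F.U) - 1 =
        -((1 - F.N) * (F.U * F.b * (D * (F.U * F.b)) * D) * F.U) := by
      have : (1 : Matrix m m (FreeAlgebra k (Fin g))) = (1 - F.N) * F.U := F.mul_U.symm
      nth_rewrite 2 [this]
      have h0 : F.U * F.b * (D * (F.U * F.b)) * D = F.U * F.b * D * (F.U * F.b * D) := by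
        simp only [Matrix.mul_assoc]
      rw [hT2, h0]
      noncomm_ring
    have h2 : K.MatMem (T.submatrix e e * ((1 + F.U * F.b * D) * F.U) - 1) := by
      rw [h1, hD]
      refine ((TwoSidedIdeal.MatMem.mul_left _ ?_).mul_right _).neg
      exact TwoSidedIdeal.MatMem.mul_right (TwoSidedIdeal.MatMem.mul_left _ fun _ _ => hK) _
    intro r s
    have h3 := h2 (e.symm r) (e.symm s)
    have h4 : T * ((1 + F.U * F.b * D) * F.U).submatrix e.symm e.symm =
        (T.submatrix e e * ((1 + F.U * F.b * D) * F.U)).submatrix e.symm e.symm := by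
      rw [← Matrix.submatrix_mul_equiv (T.submatrix e e) _ e.symm e.symm e.symm,
        Matrix.submatrix_submatrix]
      simp
    change (T * ((1 + F.U * F.b * D) * F.U).submatrix e.symm e.symm - 1) r s ∈ K
    rw [h4]
    simpa [Matrix.one_apply] using h3
  · rintro ⟨V, hV⟩
    have hV' : K.MatMem (T.submatrix e e * V.submatrix e e - 1) := by
      intro i j
      rw [Matrix.submatrix_mul_equiv]
      have := hV (e i) (e j)
      simpa [Matrix.one_apply] using this
    -- The row `D U` satisfies `D U T = (1 - f) D`, which is zero modulo `K`. Right invertibility of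
    -- `T` would then kill `D U`, hence also `f = D U b`, putting `1` in `K`.
    have h1 : K.MatMem (D * F.U * T.submatrix e e) := by
      have : D * F.U * T.submatrix e e = (1 - D * (F.U * F.b)) * D := by
        rw [Matrix.mul_assoc, hT1, Matrix.mul_sub, Matrix.sub_mul, Matrix.mul_one, Matrix.one_mul]
        simp only [Matrix.mul_assoc]
      rw [this, hD]
      refine TwoSidedIdeal.MatMem.mul_right (fun i j => ?_) _
      simpa using hfK
    have h2 : K.MatMem (D * F.U) := by
      have : D * F.U = D * F.U * T.submatrix e e * V.submatrix e e -
          D * F.U * (T.submatrix e e * V.submatrix e e - 1) := by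
        rw [Matrix.mul_sub, Matrix.mul_one, ← Matrix.mul_assoc, sub_sub_cancel]
      rw [this]
      exact (h1.mul_right _).sub (hV'.mul_left _)
    have h3 : f ∈ K := by
      have := h2.mul_right F.b () ()
      rw [Matrix.mul_assoc, hD] at this
      exact this
    refine hK ((TwoSidedIdeal.one_mem_iff K).1 ?_)
    have := K.add_mem hfK h3
    rwa [sub_add_cancel] at this

end FreeLocus

/-! ## Ideals of pencils -/

/-- The inverse of a unit in a finite-dimensional algebra is a polynomial in that unit. -/
theorem exists_mul_aeval_eq_one_of_isUnit {k E : Type*} [Field k] [Ring E] [Algebra k E]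
    [FiniteDimensional k E] {a : E} (ha : IsUnit a) : ∃ q : Polynomial k, a * q.aeval a = 1 := by
  let B := Algebra.adjoin k {a}
  let b : B := ⟨a, Algebra.self_mem_adjoin_singleton k a⟩
  -- In `k[a]` the element `a` is integral over `k` and not a zero divisor, so its inverse already
  -- lies in `k[a]`.
  have hb : IsUnit b := by
    refine IsArtinianRing.isUnit_of_isIntegral_of_nonZeroDivisor (R := k) (Algebra.IsIntegral.isIntegral b) ?_
    rw [mem_nonZeroDivisors_iff]
    constructor
    · intro x hx
      exact Subtype.ext (ha.mul_right_eq_zero.1 (congrArg Subtype.val hx))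
    · intro x hx
      exact Subtype.ext (ha.mul_left_eq_zero.1 (congrArg Subtype.val hx))
  obtain ⟨c, hc⟩ := hb.exists_right_inv
  have hc' : (c : E) ∈ Algebra.adjoin k {a} := c.2
  rw [Algebra.adjoin_singleton_eq_range_aeval] at hc'
  obtain ⟨q, hq⟩ := hc'
  refine ⟨q, ?_⟩
  have hq' : q.aeval a = (c : E) := hq
  rw [hq']
  exact congrArg Subtype.val hc

namespace FreeLocus

variable {k : Type u} [Field k] {g : ℕ}

/-- The locus of an ideal: the tuples which are not regular modulo it. -/
def locus (K : TwoSidedIdeal (FreeAlgebra k (Fin g))) : Set (MatrixTuple k g) :=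
  {X | ¬ IsRegular K X}

/-- The polynomials vanishing at the coefficients of a pencil. -/
noncomputable def coeffIdeal (L : MonicPencil k g) : TwoSidedIdeal (FreeAlgebra k (Fin g)) :=
  TwoSidedIdeal.ker (FreeAlgebra.lift k L.coeff)

theorem mem_coeffIdeal {L : MonicPencil k g} {r : FreeAlgebra k (Fin g)} :
    r ∈ coeffIdeal L ↔ FreeAlgebra.lift k L.coeff r = 0 := TwoSidedIdeal.mem_ker _

theorem cofinite_coeffIdeal (L : MonicPencil k g) : (coeffIdeal L).Cofinite k := by
  let f := Ideal.Quotient.liftₐ (coeffIdeal L).asIdeal (FreeAlgebra.lift k L.coeff)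
    fun _ ha => mem_coeffIdeal.1 ha
  refine Module.Finite.of_injective f.toLinearMap ((injective_iff_map_eq_zero f).2 fun x hx => ?_)
  obtain ⟨r, rfl⟩ := Ideal.Quotient.mk_surjective x
  exact Ideal.Quotient.eq_zero_iff_mem.2 (mem_coeffIdeal.2 hx)

/-- Up to reordering the tensor factors, `L(X)` is the generic pencil of `X` with its variables
evaluated at the coefficients of `L`. -/
theorem freeLocus_eq_locus (L : MonicPencil k g) : L.freeLocus = locus (coeffIdeal L) := by
  ext ⟨n, X⟩
  let ρ := FreeAlgebra.lift k L.coeff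
  let ψ : Matrix (Fin n) (Fin n) (FreeAlgebra k (Fin g)) →ₐ[k]
    Matrix (Fin n) (Fin n) (Matrix (Fin L.size) (Fin L.size) k) := ρ.mapMatrix
  let χ := Matrix.compRingEquiv (Fin n) (Fin L.size) k
  have heval : L.eval X = (χ (ψ (genericPencil X))).submatrix (Equiv.prodComm _ _)
      (Equiv.prodComm _ _) := by
    ext ⟨a, r⟩ ⟨b, s⟩
    have h1 : (1 : Matrix (Fin n) (Fin n) (Matrix (Fin L.size) (Fin L.size) k)) r s a b =
        (1 : Matrix (Fin L.size) (Fin L.size) k) a b * (1 : Matrix (Fin n) (Fin n) k) r s := by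
      by_cases h : r = s
      · rw [h, Matrix.one_apply_eq, Matrix.one_apply_eq, mul_one]
      · rw [Matrix.one_apply_ne h, Matrix.one_apply_ne h, mul_zero, Matrix.zero_apply]
    have h2 : ψ (genericPencil X) r s a b = (1 : Matrix (Fin L.size) (Fin L.size) k) a b *
        (1 : Matrix (Fin n) (Fin n) k) r s - ∑ i, L.coeff i a b * X i r s := by
      rw [genericPencil, map_sub, map_one, map_sum, Matrix.sub_apply, Matrix.sub_apply, h1,
        Matrix.sum_apply, Matrix.sum_apply]
      congr 1
      refine Finset.sum_congr rfl fun i _ => ?_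
      change ρ (X i r s • FreeAlgebra.ι k i) a b = _
      rw [map_smul, FreeAlgebra.lift_ι_apply, Matrix.smul_apply, smul_eq_mul, mul_comm]
    change _ = ψ (genericPencil X) r s a b
    rw [h2]
    have h3 : (1 : Matrix (Fin L.size × Fin n) (Fin L.size × Fin n) k) (a, r) (b, s) =
        (1 : Matrix (Fin L.size) (Fin L.size) k) a b * (1 : Matrix (Fin n) (Fin n) k) r s := by
      rw [← Matrix.one_kronecker_one, Matrix.kroneckerMap_apply]
    simp [MonicPencil.eval, Matrix.sum_apply, Matrix.kroneckerMap_apply, h3]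
  have hdet : (L.eval X).det = 0 ↔ ¬ IsUnit (ψ (genericPencil X)) := by
    rw [heval, Matrix.det_submatrix_equiv_self, ← MulEquiv.isUnit_map χ,
      Matrix.isUnit_iff_isUnit_det, isUnit_iff_ne_zero, not_not]
  change (L.eval X).det = 0 ↔ ¬ IsRegular _ _
  rw [hdet, not_iff_not]
  constructor
  · intro h
    -- Entries of an arbitrary inverse need not be values of polynomials in the coefficients.
    -- Writing the inverse as a polynomial in the evaluated pencil lifts it to the free algebra.
    obtain ⟨q, hq⟩ := exists_mul_aeval_eq_one_of_isUnit (k := k) h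
    refine ⟨q.aeval (genericPencil X), fun r s => mem_coeffIdeal.2 ?_⟩
    have : ψ (genericPencil X * q.aeval (genericPencil X) - 1) = 0 := by
      rw [map_sub, map_mul, ← Polynomial.aeval_algHom_apply, hq, map_one, sub_self]
    exact congrFun (congrFun this r) s
  · rintro ⟨U, hU⟩
    have h : ψ (genericPencil X * U - 1) = 0 := by
      refine Matrix.ext fun r s => ?_
      exact mem_coeffIdeal.1 (hU r s)
    rw [map_sub, map_mul, map_one, sub_eq_zero] at h
    rw [← MulEquiv.isUnit_map χ]
    refine IsUnit.of_mul_eq_one (χ (ψ U)) ?_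
    rw [← map_mul, h, map_one]

/-- Every finite-dimensional module over the free algebra comes from a pencil. -/
theorem exists_pencil_of_module (M : Type*) [AddCommGroup M] [Module k M]
    [Module (FreeAlgebra k (Fin g)) M] [IsScalarTower k (FreeAlgebra k (Fin g)) M]
    [FiniteDimensional k M] :
    ∃ L : MonicPencil k g, L.size = Module.finrank k M ∧
      ∀ r, r ∈ coeffIdeal L ↔ ∀ m : M, r • m = 0 := by
  let b := Module.finBasis k M
  let φ : FreeAlgebra k (Fin g) →ₐ[k] Module.End k M := Algebra.lsmul k k M
  let e := algEquivMatrix b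
  refine ⟨⟨Module.finrank k M, fun i => e (φ (FreeAlgebra.ι k i))⟩, rfl, fun r => ?_⟩
  have : FreeAlgebra.lift k (fun i => e (φ (FreeAlgebra.ι k i))) = e.toAlgHom.comp φ := by
    ext i : 2
    simp
  rw [mem_coeffIdeal]
  change FreeAlgebra.lift k (fun i => e (φ (FreeAlgebra.ι k i))) r = 0 ↔ _
  rw [this]
  change e (φ r) = 0 ↔ _
  rw [map_eq_zero_iff e e.injective, LinearMap.ext_iff]
  rfl

/-- Left multiplication on `F / K` is a finite-dimensional module; its annihilator is `K`, as the
action on the class of `1` shows. -/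
theorem exists_pencil_of_cofinite {K : TwoSidedIdeal (FreeAlgebra k (Fin g))}
    (hK : K.Cofinite k) : ∃ L : MonicPencil k g, coeffIdeal L = K := by
  have : FiniteDimensional k (FreeAlgebra k (Fin g) ⧸ K.asIdeal) := hK
  obtain ⟨L, -, hL⟩ := exists_pencil_of_module (k := k) (g := g)
    (FreeAlgebra k (Fin g) ⧸ K.asIdeal)
  refine ⟨L, TwoSidedIdeal.ext fun r => (hL r).trans ⟨fun h => ?_, fun h m => ?_⟩⟩
  · have h1 : Ideal.Quotient.mk K.asIdeal (r * 1) = 0 := h (Ideal.Quotient.mk K.asIdeal 1)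
    rw [mul_one] at h1
    exact Ideal.Quotient.eq_zero_iff_mem.1 h1
  · obtain ⟨m, rfl⟩ := Ideal.Quotient.mk_surjective m
    exact Ideal.Quotient.eq_zero_iff_mem.2 (K.mul_mem_right _ _ h)

/-- The coefficient space of a pencil as a module over the free algebra. -/
def CoeffModule (L : MonicPencil k g) : Type u := Fin L.size → k

noncomputable instance (L : MonicPencil k g) : AddCommGroup (CoeffModule L) :=
  inferInstanceAs (AddCommGroup (Fin L.size → k))

noncomputable instance (L : MonicPencil k g) : Module k (CoeffModule L) :=
  inferInstanceAs (Module k (Fin L.size → k))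

instance (L : MonicPencil k g) : FiniteDimensional k (CoeffModule L) :=
  inferInstanceAs (FiniteDimensional k (Fin L.size → k))

theorem finrank_coeffModule (L : MonicPencil k g) :
    Module.finrank k (CoeffModule L) = L.size := Module.finrank_fin_fun k

/-- The action of the free algebra through the coefficients. -/
noncomputable def coeffAction (L : MonicPencil k g) :
    FreeAlgebra k (Fin g) →ₐ[k] Module.End k (CoeffModule L) :=
  (Matrix.toLinAlgEquiv' (R := k) (n := Fin L.size)).toAlgHom.comp (FreeAlgebra.lift k L.coeff)

noncomputable instance (L : MonicPencil k g) :
    Module (FreeAlgebra k (Fin g)) (CoeffModule L) :=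
  Module.compHom (CoeffModule L) (coeffAction L).toRingHom

instance (L : MonicPencil k g) : IsScalarTower k (FreeAlgebra k (Fin g)) (CoeffModule L) where
  smul_assoc c r m := by
    change coeffAction L (c • r) m = c • coeffAction L r m
    rw [map_smul, LinearMap.smul_apply]

theorem mem_coeffIdeal_iff_smul_eq_zero {L : MonicPencil k g} {r : FreeAlgebra k (Fin g)} :
    r ∈ coeffIdeal L ↔ ∀ m : CoeffModule L, r • m = 0 := by
  rw [mem_coeffIdeal,
    ← map_eq_zero_iff (Matrix.toLinAlgEquiv' (R := k) (n := Fin L.size))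
      (AlgEquiv.injective _), LinearMap.ext_iff]
  rfl

end FreeLocus

/-! ## Irreducible loci -/

namespace FreeLocus

variable {k : Type u} [Field k] {g : ℕ}

theorem isCoatom_augIdeal : IsCoatom (augIdeal k g) := by
  refine ⟨fun h => ?_, fun Q hQ => ?_⟩
  · have h1 : (1 : FreeAlgebra k (Fin g)) ∈ augIdeal k g := h ▸ TwoSidedIdeal.mem_top _
    rw [mem_augIdeal, map_one] at h1
    exact one_ne_zero h1
  · obtain ⟨r, hr, hr'⟩ := Set.exists_of_ssubset ((TwoSidedIdeal.lt_iff _ _).1 hQ)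
    have hr0 : FreeAlgebra.algebraMapInv r ≠ 0 := fun h => hr' (mem_augIdeal.2 h)
    set c := FreeAlgebra.algebraMapInv r with hc
    have h1 : r - algebraMap k _ c ∈ augIdeal k g := by
      rw [mem_augIdeal, map_sub, FreeAlgebra.algebraMap_leftInverse, hc, sub_self]
    have h2 : algebraMap k (FreeAlgebra k (Fin g)) c ∈ Q := by
      have := Q.sub_mem hr (hQ.le h1)
      rwa [sub_sub_cancel] at this
    rw [← TwoSidedIdeal.one_mem_iff]
    have := Q.mul_mem_left (algebraMap k _ c⁻¹) _ h2
    rwa [← map_mul, inv_mul_cancel₀ hr0, map_one] at this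

/-- The maximal two-sided ideals of finite codimension other than the augmentation ideal. They
parametrize the irreducible free loci. -/
structure IsPointIdeal (P : TwoSidedIdeal (FreeAlgebra k (Fin g))) : Prop where
  cofinite : P.Cofinite k
  isCoatom : IsCoatom P
  ne_augIdeal : P ≠ augIdeal k g

namespace IsPointIdeal

variable {P : TwoSidedIdeal (FreeAlgebra k (Fin g))}

theorem isPrimeIdeal (hP : IsPointIdeal P) : P.IsPrimeIdeal :=
  TwoSidedIdeal.isPrimeIdeal_of_isCoatom hP.isCoatom

theorem not_augIdeal_le (hP : IsPointIdeal P) : ¬ augIdeal k g ≤ P := fun h =>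
  (isCoatom_augIdeal.le_iff.1 h).elim hP.isCoatom.1 hP.ne_augIdeal

theorem eq_of_le (hP : IsPointIdeal P) {Q : TwoSidedIdeal (FreeAlgebra k (Fin g))}
    (hQ : IsPointIdeal Q) (h : P ≤ Q) : P = Q :=
  ((hP.isCoatom.le_iff.1 h).resolve_left hQ.isCoatom.1).symm

end IsPointIdeal

/-! ### Loci of ideals, and inclusions between them -/

theorem locus_anti {K K' : TwoSidedIdeal (FreeAlgebra k (Fin g))} (h : K ≤ K') :
    locus K' ⊆ locus K := fun _ hX hX' => hX (hX'.mono h)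

theorem locus_eq_union {K I J : TwoSidedIdeal (FreeAlgebra k (Fin g))} (hI : K ≤ I) (hJ : K ≤ J)
    (h : ∀ a ∈ I, ∀ b ∈ J, a * b ∈ K) : locus K = locus I ∪ locus J := by
  refine Set.Subset.antisymm (fun X hX => ?_) (Set.union_subset (locus_anti hI) (locus_anti hJ))
  by_contra hc
  rw [Set.mem_union, not_or] at hc
  exact hX ((not_not.1 hc.1).of_mul h (not_not.1 hc.2))

theorem locus_top : locus (⊤ : TwoSidedIdeal (FreeAlgebra k (Fin g))) = ∅ :=
  Set.eq_empty_of_forall_notMem fun X hX => hX (isRegular_top X)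

theorem locus_augIdeal : locus (augIdeal k g) = ∅ :=
  Set.eq_empty_of_forall_notMem fun X hX => hX (isRegular_augIdeal X)

theorem IsPointIdeal.locus_subset_iff {P : TwoSidedIdeal (FreeAlgebra k (Fin g))}
    (hP : IsPointIdeal P) {K : TwoSidedIdeal (FreeAlgebra k (Fin g))} :
    locus P ⊆ locus K ↔ K ≤ P := by
  refine ⟨fun h => ?_, locus_anti⟩
  by_contra hK
  -- Realizations exist only for polynomials without constant term, so the separating `f` is sought
  -- in this intersection; primeness of `P` keeps it outside `P`.
  have hI : ¬ augIdeal k g ⊓ K ≤ P := by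
    intro hle
    refine (hP.isPrimeIdeal (augIdeal k g) K fun a ha b hb => hle ?_).elim hP.not_augIdeal_le hK
    exact (TwoSidedIdeal.mem_inf _).2
      ⟨TwoSidedIdeal.mul_mem_right _ _ _ ha, TwoSidedIdeal.mul_mem_left _ _ _ hb⟩
  obtain ⟨f, hf, p, hp, hfp⟩ := TwoSidedIdeal.exists_add_eq_one_of_isCoatom hP.isCoatom hI
  obtain ⟨hfa, hfK⟩ := (TwoSidedIdeal.mem_inf _).1 hf
  obtain ⟨X, hX, hX'⟩ := exists_isRegular_and_not_isRegular hfa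
  have h1 : 1 - f ∈ P := by rwa [← hfp, add_sub_cancel_left]
  exact h (hX' P hP.isCoatom.1 h1) (hX K hfK)

theorem IsPointIdeal.nonempty_locus {P : TwoSidedIdeal (FreeAlgebra k (Fin g))}
    (hP : IsPointIdeal P) : (locus P).Nonempty := by
  rw [Set.nonempty_iff_ne_empty]
  intro h
  have h1 : locus P ⊆ locus ⊤ := h ▸ Set.empty_subset _
  exact hP.isCoatom.1 (top_le_iff.1 (hP.locus_subset_iff.1 h1))

/-- The locus of an ideal of finite codimension is the union of the loci of the maximal ideals
above it. -/
theorem locus_eq_sUnion {K : TwoSidedIdeal (FreeAlgebra k (Fin g))} (hK : K.Cofinite k) :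
    locus K = ⋃₀ (locus '' {P | IsPointIdeal P ∧ K ≤ P}) := by
  refine Set.Subset.antisymm (fun X hX => ?_) ?_
  · by_contra hc
    have key : ∀ P, IsPointIdeal P → K ≤ P → IsRegular P X := fun P hP hKP => by
      by_contra hPX
      exact hc ⟨locus P, ⟨P, ⟨hP, hKP⟩, rfl⟩, hPX⟩
    refine hX ?_
    clear hX hc
    revert key
    refine TwoSidedIdeal.Cofinite.induction (k := k)
      (C := fun K => (∀ P, IsPointIdeal P → K ≤ P → IsRegular P X) → IsRegular K X)
      (fun _ => isRegular_top X) (fun P hf hP h => ?_) (fun K I J hI hJ hIJ ihI ihJ h => ?_) K hK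
    · by_cases hne : P = augIdeal k g
      · rw [hne]; exact isRegular_augIdeal X
      · exact h P ⟨hf, hP, hne⟩ le_rfl
    · exact (ihI fun P hP hIP => h P hP (hI.trans hIP)).of_mul hIJ
        (ihJ fun P hP hJP => h P hP (hJ.trans hJP))
  · rintro X ⟨_, ⟨P, ⟨-, hP⟩, rfl⟩, hX⟩
    exact locus_anti hP hX

theorem isFreeLocus_locus {K : TwoSidedIdeal (FreeAlgebra k (Fin g))} (hK : K.Cofinite k) :
    IsFreeLocus (locus K) := by
  obtain ⟨L, hL⟩ := exists_pencil_of_cofinite hK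
  exact ⟨L, by rw [freeLocus_eq_locus, hL]⟩

theorem IsPointIdeal.isIrreducibleFreeLocus {P : TwoSidedIdeal (FreeAlgebra k (Fin g))}
    (hP : IsPointIdeal P) : IsIrreducibleFreeLocus (locus P) := by
  refine ⟨isFreeLocus_locus hP.cofinite, hP.nonempty_locus, ?_⟩
  rintro ⟨_, _, ⟨L₁, rfl⟩, ⟨L₂, rfl⟩, h₁, h₂, h⟩
  rw [freeLocus_eq_locus, freeLocus_eq_locus] at h
  rw [freeLocus_eq_locus] at h₁ h₂
  have hprod : ∀ a ∈ coeffIdeal L₁, ∀ b ∈ coeffIdeal L₂, a * b ∈ coeffIdeal L₁ ⊓ coeffIdeal L₂ :=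
    fun a ha b hb => (TwoSidedIdeal.mem_inf _).2
      ⟨TwoSidedIdeal.mul_mem_right _ _ _ ha, TwoSidedIdeal.mul_mem_left _ _ _ hb⟩
  rw [← locus_eq_union inf_le_left inf_le_right hprod] at h
  have hle := hP.locus_subset_iff.1 h.subset
  rcases hP.isPrimeIdeal _ _ fun a ha b hb => hle (hprod a ha b hb) with hc | hc
  · exact h₁.2 (locus_anti hc)
  · exact h₂.2 (locus_anti hc)

/-! ## Minimal pencils of irreducible free loci -/

theorem exists_isMinimal {Z : Set (MatrixTuple k g)} (hZ : IsFreeLocus Z) :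
    ∃ L : MonicPencil k g, L.IsMinimal ∧ L.freeLocus = Z := by
  classical
  have hex : ∃ n, ∃ L : MonicPencil k g, L.freeLocus = Z ∧ L.size = n := by
    obtain ⟨L, hL⟩ := hZ
    exact ⟨_, L, hL, rfl⟩
  obtain ⟨L, hL, hn⟩ := Nat.find_spec hex
  refine ⟨L, fun L' hL' => ?_, hL⟩
  rw [hn]
  exact Nat.find_min' hex ⟨L', hL'.trans hL, rfl⟩

/-- The coefficients of a minimal pencil of an irreducible free locus have no common invariant
subspaces. -/
theorem eq_bot_or_eq_top_of_isMinimal {L : MonicPencil k g} (hmin : L.IsMinimal)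
    (hirr : IsIrreducibleFreeLocus L.freeLocus)
    (W : Submodule (FreeAlgebra k (Fin g)) (CoeffModule L)) : W = ⊥ ∨ W = ⊤ := by
  by_contra! hW
  have hWf : FiniteDimensional k W :=
    inferInstanceAs (FiniteDimensional k (W.restrictScalars k))
  have hQs : Function.Surjective (W.mkQ.restrictScalars k) := W.mkQ_surjective
  have hQf : FiniteDimensional k (CoeffModule L ⧸ W) := Module.Finite.of_surjective _ hQs
  obtain ⟨L₁, hs₁, hL₁⟩ := exists_pencil_of_module (k := k) (g := g) W
  obtain ⟨L₂, hs₂, hL₂⟩ := exists_pencil_of_module (k := k) (g := g) (CoeffModule L ⧸ W)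
  have hlt₁ : L₁.size < L.size := by
    rw [hs₁, ← finrank_coeffModule L]
    refine Submodule.finrank_lt (s := W.restrictScalars k) fun h => hW.2 ?_
    exact (Submodule.restrictScalars_eq_top_iff _ _ _).1 h
  have hlt₂ : L₂.size < L.size := by
    rw [hs₂, ← finrank_coeffModule L]
    have hr := (W.mkQ.restrictScalars k).finrank_range_add_finrank_ker
    rw [LinearMap.range_eq_top.2 hQs, finrank_top] at hr
    have hker : Nontrivial (LinearMap.ker (W.mkQ.restrictScalars k)) := by
      obtain ⟨w, hw, hw0⟩ := Submodule.exists_mem_ne_zero_of_ne_bot hW.1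
      refine ⟨⟨⟨w, ?_⟩, 0, fun h => hw0 (congrArg Subtype.val h)⟩⟩
      change W.mkQ w = 0
      exact (Submodule.Quotient.mk_eq_zero W).2 hw
    have := Module.finrank_pos (R := k) (M := LinearMap.ker (W.mkQ.restrictScalars k))
    omega
  have hle₁ : coeffIdeal L ≤ coeffIdeal L₁ := fun r hr =>
    (hL₁ r).2 fun m => Subtype.ext (mem_coeffIdeal_iff_smul_eq_zero.1 hr m)
  have hle₂ : coeffIdeal L ≤ coeffIdeal L₂ := fun r hr => (hL₂ r).2 fun m => by
    obtain ⟨m, rfl⟩ := W.mkQ_surjective m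
    rw [← map_smul, mem_coeffIdeal_iff_smul_eq_zero.1 hr m, map_zero]
  -- Here `b` maps the whole space into `W`, and `a` kills `W`.
  have hmul : ∀ a ∈ coeffIdeal L₁, ∀ b ∈ coeffIdeal L₂, a * b ∈ coeffIdeal L := by
    intro a ha b hb
    refine mem_coeffIdeal_iff_smul_eq_zero.2 fun m => ?_
    have hbm : b • m ∈ W := by
      rw [← Submodule.Quotient.mk_eq_zero, Submodule.Quotient.mk_smul]
      exact (hL₂ b).1 hb _
    rw [mul_smul]
    exact congrArg Subtype.val ((hL₁ a).1 ha ⟨b • m, hbm⟩)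
  have hunion : L.freeLocus = L₁.freeLocus ∪ L₂.freeLocus := by
    rw [freeLocus_eq_locus, freeLocus_eq_locus, freeLocus_eq_locus]
    exact locus_eq_union hle₁ hle₂ hmul
  refine hirr.2.2 ⟨L₁.freeLocus, L₂.freeLocus, ⟨L₁, rfl⟩, ⟨L₂, rfl⟩, ?_, ?_, hunion⟩
  · exact LE.le.ssubset_of_ne (hunion ▸ Set.subset_union_left)
      fun h => hlt₁.not_ge (hmin L₁ h)
  · exact LE.le.ssubset_of_ne (hunion ▸ Set.subset_union_right)
      fun h => hlt₂.not_ge (hmin L₂ h)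

/-- The annihilator of a module without proper nonzero submodules is prime: if `I J` kills it, the
vectors killed by `I` form a submodule containing the image of `J`. -/
theorem isPointIdeal_coeffIdeal_of_isMinimal {L : MonicPencil k g} (hmin : L.IsMinimal)
    (hirr : IsIrreducibleFreeLocus L.freeLocus) : IsPointIdeal (coeffIdeal L) := by
  have hne := hirr.2.1.ne_empty
  rw [freeLocus_eq_locus] at hne
  have htop : coeffIdeal L ≠ ⊤ := fun h => hne (by rw [h, locus_top])
  refine ⟨cofinite_coeffIdeal L, ?_, fun h => hne (by rw [h, locus_augIdeal])⟩
  refine (cofinite_coeffIdeal L).isCoatom_of_isPrimeIdeal (fun I J hIJ => ?_) htop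
  by_contra! hc
  obtain ⟨b, hb, hbL⟩ := Set.not_subset.1 hc.2
  have : ∃ m : CoeffModule L, b • m ≠ 0 := by
    by_contra! h
    exact hbL (mem_coeffIdeal_iff_smul_eq_zero.2 h)
  obtain ⟨m, hm⟩ := this
  let W : Submodule (FreeAlgebra k (Fin g)) (CoeffModule L) :=
    { carrier := {m | ∀ a ∈ I, a • m = 0}
      add_mem' := fun hx hy a ha => by rw [smul_add, hx a ha, hy a ha, add_zero]
      zero_mem' := fun a _ => smul_zero a
      smul_mem' := fun r x hx a ha => by
        rw [← mul_smul]; exact hx _ (I.mul_mem_right _ _ ha) }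
  have hbm : b • m ∈ W := fun a ha => by
    rw [← mul_smul]
    exact mem_coeffIdeal_iff_smul_eq_zero.1 (hIJ a ha b hb) m
  rcases eq_bot_or_eq_top_of_isMinimal hmin hirr W with h | h
  · rw [h] at hbm
    exact hm hbm
  · refine hc.1 fun a ha => mem_coeffIdeal_iff_smul_eq_zero.2 fun x => ?_
    have hx : x ∈ W := h ▸ Submodule.mem_top
    exact hx a ha

theorem exists_locus_eq_of_isIrreducible {Z : Set (MatrixTuple k g)}
    (hZ : IsIrreducibleFreeLocus Z) : ∃ P, IsPointIdeal P ∧ locus P = Z := by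
  obtain ⟨L, hmin, rfl⟩ := exists_isMinimal hZ.1
  exact ⟨_, isPointIdeal_coeffIdeal_of_isMinimal hmin hZ, (freeLocus_eq_locus L).symm⟩

/-! ### Components as point ideals above an ideal -/

theorem freeLocusComponents_locus (K : TwoSidedIdeal (FreeAlgebra k (Fin g))) :
    freeLocusComponents (locus K) = locus '' {P | IsPointIdeal P ∧ K ≤ P} := by
  ext W
  constructor
  · rintro ⟨⟨hW, hWK⟩, -⟩
    obtain ⟨P, hP, rfl⟩ := exists_locus_eq_of_isIrreducible hW
    exact ⟨P, ⟨hP, hP.locus_subset_iff.1 hWK⟩, rfl⟩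
  · rintro ⟨P, ⟨hP, hKP⟩, rfl⟩
    refine ⟨⟨hP.isIrreducibleFreeLocus, locus_anti hKP⟩, ?_⟩
    rintro V ⟨hV, -⟩ hPV
    obtain ⟨Q, hQ, rfl⟩ := exists_locus_eq_of_isIrreducible hV
    rw [hQ.eq_of_le hP (hP.locus_subset_iff.1 hPV)]

theorem encard_freeLocusComponents_locus (K : TwoSidedIdeal (FreeAlgebra k (Fin g))) :
    (freeLocusComponents (locus K)).encard = {P | IsPointIdeal P ∧ K ≤ P}.encard := by
  rw [freeLocusComponents_locus]
  refine Set.InjOn.encard_image fun P hP Q hQ h => ?_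
  exact (hQ.1.eq_of_le hP.1 (hP.1.locus_subset_iff.1 h.subset)).symm

end FreeLocus

/-! ## Regular maximal ideals of a nonunital algebra -/

section NonUnitalAlgebra

variable {k : Type u} {A : Type v} [Field k] [NonUnitalRing A] [Module k A]

/-- A maximal two-sided ideal with nonzero multiplication on the quotient. -/
structure IsRegularMaximal (p : Submodule k A) : Prop where
  isTwoSided : IsTwoSidedAlgIdeal p
  exists_mul_notMem : ∃ a b, a * b ∉ p
  eq_or_eq_top : ∀ I : Submodule k A, IsTwoSidedAlgIdeal I → p ≤ I → I = p ∨ I = ⊤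

theorem isRegularMaximal_bot_iff : IsRegularMaximal (⊥ : Submodule k A) ↔ IsSimpleAlg k A := by
  refine ⟨fun h => ⟨h.exists_mul_notMem, fun I hI => h.eq_or_eq_top I hI bot_le⟩, fun h =>
    ⟨⟨fun a x hx => ?_, fun a x hx => ?_⟩, h.exists_mul_ne_zero, fun I hI _ =>
      h.eq_bot_or_eq_top I hI⟩⟩
  · rw [(Submodule.mem_bot k).1 hx, mul_zero]; exact Submodule.zero_mem _
  · rw [(Submodule.mem_bot k).1 hx, zero_mul]; exact Submodule.zero_mem _

theorem IsTwoSidedAlgIdeal.sup {I J : Submodule k A} (hI : IsTwoSidedAlgIdeal I)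
    (hJ : IsTwoSidedAlgIdeal J) : IsTwoSidedAlgIdeal (I ⊔ J) where
  mul_mem_left a x hx := by
    obtain ⟨y, hy, z, hz, rfl⟩ := Submodule.mem_sup.1 hx
    rw [mul_add]
    exact Submodule.add_mem_sup (hI.mul_mem_left a y hy) (hJ.mul_mem_left a z hz)
  mul_mem_right a x hx := by
    obtain ⟨y, hy, z, hz, rfl⟩ := Submodule.mem_sup.1 hx
    rw [add_mul]
    exact Submodule.add_mem_sup (hI.mul_mem_right a y hy) (hJ.mul_mem_right a z hz)

theorem IsTwoSidedAlgIdeal.inf {I J : Submodule k A} (hI : IsTwoSidedAlgIdeal I)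
    (hJ : IsTwoSidedAlgIdeal J) : IsTwoSidedAlgIdeal (I ⊓ J) where
  mul_mem_left a x hx := ⟨hI.mul_mem_left a x hx.1, hJ.mul_mem_left a x hx.2⟩
  mul_mem_right a x hx := ⟨hI.mul_mem_right a x hx.1, hJ.mul_mem_right a x hx.2⟩

namespace IsRegularMaximal

variable {p : Submodule k A}

theorem ne_top (hp : IsRegularMaximal p) : p ≠ ⊤ := fun h => by
  obtain ⟨a, b, hab⟩ := hp.exists_mul_notMem
  exact hab (h ▸ Submodule.mem_top)

theorem le_or_le (hp : IsRegularMaximal p) {I J : Submodule k A} (hI : IsTwoSidedAlgIdeal I)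
    (hJ : IsTwoSidedAlgIdeal J) (h : ∀ a ∈ I, ∀ b ∈ J, a * b ∈ p) : I ≤ p ∨ J ≤ p := by
  by_contra! hc
  have key : ∀ I : Submodule k A, IsTwoSidedAlgIdeal I → ¬ I ≤ p → I ⊔ p = ⊤ := fun I hI hIp =>
    (hp.eq_or_eq_top _ (hI.sup hp.isTwoSided) le_sup_right).resolve_left fun h =>
      hIp (h ▸ le_sup_left)
  obtain ⟨a, b, hab⟩ := hp.exists_mul_notMem
  obtain ⟨i, hi, q, hq, rfl⟩ :=
    Submodule.mem_sup.1 (key I hI hc.1 ▸ Submodule.mem_top : a ∈ I ⊔ p)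
  obtain ⟨j, hj, r, hr, rfl⟩ :=
    Submodule.mem_sup.1 (key J hJ hc.2 ▸ Submodule.mem_top : b ∈ J ⊔ p)
  refine hab ?_
  rw [add_mul, mul_add]
  exact p.add_mem (p.add_mem (h i hi j hj) (hp.isTwoSided.mul_mem_left _ _ hr))
    (hp.isTwoSided.mul_mem_right _ _ hq)

/-- The elements `a` with `A a ⊆ p` form an ideal containing `p`; it is not all of `A`, since some
product lies outside `p`. -/
theorem mem_of_forall_mul_mem_left [SMulCommClass k A A] (hp : IsRegularMaximal p) {a : A} (h : ∀ x, x * a ∈ p) :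
    a ∈ p := by
  let I : Submodule k A :=
    { carrier := {a | ∀ x, x * a ∈ p}
      add_mem' := fun ha hb x => by rw [mul_add]; exact p.add_mem (ha x) (hb x)
      zero_mem' := fun x => by rw [mul_zero]; exact p.zero_mem
      smul_mem' := fun c a ha x => by rw [mul_smul_comm]; exact p.smul_mem c (ha x) }
  have hI : IsTwoSidedAlgIdeal I :=
    ⟨fun a x hx y => by rw [← mul_assoc]; exact hx _,
      fun a x hx y => by rw [← mul_assoc]; exact hp.isTwoSided.mul_mem_right _ _ (hx y)⟩
  rcases hp.eq_or_eq_top I hI fun a ha x => hp.isTwoSided.mul_mem_left _ _ ha with hIp | hIp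
  · exact hIp ▸ (h : a ∈ I)
  · obtain ⟨x, b, hab⟩ := hp.exists_mul_notMem
    have hb : b ∈ I := hIp ▸ Submodule.mem_top
    exact absurd (hb x) hab

theorem mem_of_forall_mul_mem_right [IsScalarTower k A A] (hp : IsRegularMaximal p) {a : A} (h : ∀ x, a * x ∈ p) :
    a ∈ p := by
  let I : Submodule k A :=
    { carrier := {a | ∀ x, a * x ∈ p}
      add_mem' := fun ha hb x => by rw [add_mul]; exact p.add_mem (ha x) (hb x)
      zero_mem' := fun x => by rw [zero_mul]; exact p.zero_mem
      smul_mem' := fun c a ha x => by rw [smul_mul_assoc]; exact p.smul_mem c (ha x) }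
  have hI : IsTwoSidedAlgIdeal I :=
    ⟨fun a x hx y => by rw [mul_assoc]; exact hp.isTwoSided.mul_mem_left _ _ (hx y),
      fun a x hx y => by rw [mul_assoc]; exact hx _⟩
  rcases hp.eq_or_eq_top I hI fun a ha x => hp.isTwoSided.mul_mem_right _ _ ha with hIp | hIp
  · exact hIp ▸ (h : a ∈ I)
  · obtain ⟨b, x, hab⟩ := hp.exists_mul_notMem
    have hb : b ∈ I := hIp ▸ Submodule.mem_top
    exact absurd (hb x) hab

variable [IsScalarTower k A A] [SMulCommClass k A A]

theorem isTwoSided_algIdealPow {I : Submodule k A} (hI : IsTwoSidedAlgIdeal I) (m : ℕ) :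
    IsTwoSidedAlgIdeal (algIdealPow I m) := by
  induction m with
  | zero => exact hI
  | succ m ih =>
    constructor
    · intro a x hx
      have : algIdealPow I (m + 1) ≤ (algIdealPow I (m + 1)).comap (LinearMap.mulLeft k a) := by
        refine Submodule.span_le.2 ?_
        rintro _ ⟨x, hx, y, hy, rfl⟩
        refine Submodule.subset_span ⟨a * x, ih.mul_mem_left a x hx, y, hy, ?_⟩
        exact (mul_assoc a x y).symm
      exact this hx
    · intro a x hx
      have : algIdealPow I (m + 1) ≤ (algIdealPow I (m + 1)).comap (LinearMap.mulRight k a) := by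
        refine Submodule.span_le.2 ?_
        rintro _ ⟨x, hx, y, hy, rfl⟩
        refine Submodule.subset_span ⟨x, hx, y * a, hI.mul_mem_right a y hy, ?_⟩
        exact mul_assoc x y a
      exact this hx

theorem algRad_le (hp : IsRegularMaximal p) : algRad k A ≤ p := by
  refine sSup_le ?_
  rintro I ⟨hI, m, hm⟩
  have key : ∀ m, algIdealPow I m ≤ p → I ≤ p := by
    intro m
    induction m with
    | zero => exact id
    | succ m ih =>
      intro h
      refine (hp.le_or_le (isTwoSided_algIdealPow hI m) hI fun a ha b hb => ?_).elim ih id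
      exact h (Submodule.subset_span ⟨a, ha, b, hb, rfl⟩)
  exact key m (hm ▸ bot_le)

end IsRegularMaximal

/-- If `A / rad A` is a product of `s` simple algebras, then `A` has exactly `s` regular maximal
ideals, the kernels of the projections onto the factors. -/
theorem encard_isRegularMaximal [IsScalarTower k A A] [SMulCommClass k A A] {s : ℕ}
    {B : Fin s → Type*} [∀ j, NonUnitalRing (B j)] [∀ j, Module k (B j)]
    (hB : ∀ j, IsSimpleAlg k (B j)) (φ : RadQuotient k A →ₙₐ[k] (∀ j, B j))
    (hφ : Function.Bijective φ) : {p : Submodule k A | IsRegularMaximal p}.encard = s := by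
  let θ : ∀ j, A →ₗ[k] B j := fun j =>
    { toFun := fun a => φ ((algRad k A).mkQ a) j
      map_add' := fun a b => by rw [map_add, map_add, Pi.add_apply]
      map_smul' := fun c a => by rw [map_smul, map_smul, Pi.smul_apply]; rfl }
  have hθmul : ∀ j a b, θ j (a * b) = θ j a * θ j b := fun j a b =>
    congrFun (map_mul φ ((algRad k A).mkQ a) ((algRad k A).mkQ b)) j
  have hθ : ∀ b : ∀ j, B j, ∃ a, ∀ j, θ j a = b j := fun b => by
    obtain ⟨q, hq⟩ := hφ.2 b
    obtain ⟨a, rfl⟩ := (algRad k A).mkQ_surjective q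
    exact ⟨a, fun j => congrFun hq j⟩
  have hθs : ∀ j, Function.Surjective (θ j) := fun j b => by
    classical
    obtain ⟨a, ha⟩ := hθ (Pi.single j b)
    exact ⟨a, by rw [ha, Pi.single_eq_same]⟩
  have hker : ∀ a, (∀ j, θ j a = 0) → a ∈ algRad k A := fun a ha => by
    rw [← Submodule.Quotient.mk_eq_zero]
    refine hφ.1 ?_
    rw [map_zero]
    exact funext ha
  have hK2 : ∀ j, IsTwoSidedAlgIdeal (LinearMap.ker (θ j)) := fun j =>
    ⟨fun a x hx => by
      rw [LinearMap.mem_ker, hθmul, LinearMap.mem_ker.1 hx, mul_zero],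
      fun a x hx => by rw [LinearMap.mem_ker, hθmul, LinearMap.mem_ker.1 hx, zero_mul]⟩
  have hK : ∀ j, IsRegularMaximal (LinearMap.ker (θ j)) := fun j => by
    refine ⟨hK2 j, ?_, fun I hI hle => ?_⟩
    · obtain ⟨a, b, hab⟩ := (hB j).exists_mul_ne_zero
      obtain ⟨a, rfl⟩ := hθs j a
      obtain ⟨b, rfl⟩ := hθs j b
      exact ⟨a, b, fun h => hab (by rw [← hθmul]; exact h)⟩
    · have hmap : IsTwoSidedAlgIdeal (I.map (θ j)) := by
        constructor
        · rintro b _ ⟨x, hx, rfl⟩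
          obtain ⟨a, rfl⟩ := hθs j b
          exact ⟨a * x, hI.mul_mem_left a x hx, hθmul j a x⟩
        · rintro b _ ⟨x, hx, rfl⟩
          obtain ⟨a, rfl⟩ := hθs j b
          exact ⟨x * a, hI.mul_mem_right a x hx, hθmul j x a⟩
      have hcomap : (I.map (θ j)).comap (θ j) = I := by
        rw [Submodule.comap_map_eq, sup_eq_left.2 hle]
      rcases (hB j).eq_bot_or_eq_top _ hmap with h | h
      · left; rw [← hcomap, h]; rfl
      · right; rw [← hcomap, h, Submodule.comap_top]
  have hinj : Function.Injective fun j => LinearMap.ker (θ j) := by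
    classical
    intro i j hij
    by_contra hne
    obtain ⟨x, y, hxy⟩ := (hB i).exists_mul_ne_zero
    have hx : x ≠ 0 := fun h => hxy (by rw [h, zero_mul])
    obtain ⟨a, ha⟩ := hθ (Pi.single i x)
    have h1 : a ∈ LinearMap.ker (θ j) := by
      rw [LinearMap.mem_ker, ha, Pi.single_eq_of_ne (Ne.symm hne)]
    have hij' : LinearMap.ker (θ i) = LinearMap.ker (θ j) := hij
    have h2 : a ∈ LinearMap.ker (θ i) := by rw [hij']; exact h1
    rw [LinearMap.mem_ker, ha, Pi.single_eq_same] at h2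
    exact hx h2
  have hrange : {p : Submodule k A | IsRegularMaximal p} =
      Set.range fun j => LinearMap.ker (θ j) := by
    ext p
    refine ⟨fun hp => ?_, ?_⟩
    · by_contra hc
      have hnle : ∀ j, ¬ LinearMap.ker (θ j) ≤ p := fun j hle => by
        rcases (hK j).eq_or_eq_top p hp.isTwoSided hle with h | h
        · exact hc ⟨j, h.symm⟩
        · exact hp.ne_top h
      -- By primeness of `p`, no finite intersection of the kernels lies in `p`. But the
      -- intersection of all of them lies in the radical, which `p` contains.
      have key : ∀ S : Finset (Fin s), IsTwoSidedAlgIdeal (S.inf fun j => LinearMap.ker (θ j)) ∧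
          ¬ (S.inf fun j => LinearMap.ker (θ j)) ≤ p := by
        intro S
        induction S using Finset.cons_induction with
        | empty =>
          exact ⟨⟨fun _ _ _ => Submodule.mem_top, fun _ _ _ => Submodule.mem_top⟩, fun h =>
            hp.ne_top (top_le_iff.1 h)⟩
        | cons j S hj ih =>
          rw [Finset.inf_cons]
          refine ⟨(hK2 j).inf ih.1, fun h => ?_⟩
          refine (hp.le_or_le (hK2 j) ih.1 fun a ha b hb => h ?_).elim (hnle j) ih.2
          exact ⟨(hK2 j).mul_mem_right _ _ ha, ih.1.mul_mem_left _ _ hb⟩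
      refine (key Finset.univ).2 fun a ha => hp.algRad_le (hker a fun j => ?_)
      exact Finset.inf_le (f := fun j => LinearMap.ker (θ j)) (Finset.mem_univ j) ha
    · rintro ⟨j, rfl⟩
      exact hK j
  rw [hrange, ← Set.image_univ, hinj.encard_image, Set.encard_univ, ENat.card_eq_coe_fintype_card,
    Fintype.card_fin]

end NonUnitalAlgebra

/-! ## Maximal ideals of the free algebra and of the coefficient algebra -/

namespace FreeLocus

variable {k : Type u} [Field k] {g : ℕ}

/-- The image in the coefficient algebra of the polynomials without constant term in an ideal. -/
noncomputable def coeffImage (L : MonicPencil k g) (P : TwoSidedIdeal (FreeAlgebra k (Fin g))) :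
    Submodule k L.coeffAlgebra where
  carrier := {a | ∃ r ∈ P, r ∈ augIdeal k g ∧ FreeAlgebra.lift k L.coeff r = a}
  add_mem' := by
    rintro a b ⟨r, hr, hr', hra⟩ ⟨t, ht, ht', htb⟩
    exact ⟨r + t, P.add_mem hr ht, (augIdeal k g).add_mem hr' ht', by rw [map_add, hra, htb]; rfl⟩
  zero_mem' := ⟨0, P.zero_mem, (augIdeal k g).zero_mem, map_zero _⟩
  smul_mem' := by
    rintro c a ⟨r, hr, hr', hra⟩
    refine ⟨c • r, ?_, smul_mem_augIdeal c hr', by rw [map_smul, hra]; rfl⟩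
    rw [Algebra.smul_def]
    exact P.mul_mem_left _ _ hr

theorem exists_lift_eq (L : MonicPencil k g) (a : L.coeffAlgebra) :
    ∃ r ∈ augIdeal k g, FreeAlgebra.lift k L.coeff r = a :=
  exists_lift_eq_of_mem_adjoin L.coeff a.2

theorem isTwoSided_coeffImage (L : MonicPencil k g)
    (P : TwoSidedIdeal (FreeAlgebra k (Fin g))) : IsTwoSidedAlgIdeal (coeffImage L P) where
  mul_mem_left a x := by
    rintro ⟨r, hr, hr', hrx⟩
    obtain ⟨t, -, hta⟩ := exists_lift_eq L a
    exact ⟨t * r, P.mul_mem_left _ _ hr, (augIdeal k g).mul_mem_left _ _ hr',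
      by rw [map_mul, hrx, hta]; rfl⟩
  mul_mem_right a x := by
    rintro ⟨r, hr, hr', hrx⟩
    obtain ⟨t, -, hta⟩ := exists_lift_eq L a
    exact ⟨r * t, P.mul_mem_right _ _ hr, (augIdeal k g).mul_mem_right _ _ hr',
      by rw [map_mul, hrx, hta]; rfl⟩

theorem mem_of_lift_mem_coeffImage {L : MonicPencil k g}
    {P : TwoSidedIdeal (FreeAlgebra k (Fin g))} (hP : coeffIdeal L ≤ P) {a : L.coeffAlgebra}
    (ha : a ∈ coeffImage L P) {r : FreeAlgebra k (Fin g)}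
    (hr : FreeAlgebra.lift k L.coeff r = a) : r ∈ P := by
  obtain ⟨t, ht, -, hta⟩ := ha
  have h : r - t ∈ P := hP (mem_coeffIdeal.2 (by rw [map_sub, hr, hta, sub_self]))
  have := P.add_mem h ht
  rwa [sub_add_cancel] at this

/-- The polynomials without constant term whose value at the coefficients lies in `I`. -/
noncomputable def coeffPreimage (L : MonicPencil k g) {I : Submodule k L.coeffAlgebra}
    (hI : IsTwoSidedAlgIdeal I) : TwoSidedIdeal (FreeAlgebra k (Fin g)) :=
  TwoSidedIdeal.mk' {r | r ∈ augIdeal k g ∧ ∃ a ∈ I, FreeAlgebra.lift k L.coeff r = a}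
    ⟨(augIdeal k g).zero_mem, 0, I.zero_mem, map_zero _⟩
    (by
      rintro r t ⟨hr, a, ha, hra⟩ ⟨ht, b, hb, htb⟩
      exact ⟨(augIdeal k g).add_mem hr ht, a + b, I.add_mem ha hb, by rw [map_add, hra, htb]; rfl⟩)
    (by
      rintro r ⟨hr, a, ha, hra⟩
      exact ⟨(augIdeal k g).neg_mem hr, -a, I.neg_mem ha, by rw [map_neg, hra]; rfl⟩)
    (by
      rintro t r ⟨hr, a, ha, hra⟩
      -- The value of `t` may lie outside the nonunital coefficient algebra, so its constant term is
      -- split off and acts as a scalar.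
      refine ⟨(augIdeal k g).mul_mem_left _ _ hr,
        ⟨_, lift_sub_algebraMap_mem_adjoin L.coeff t⟩ * a + FreeAlgebra.algebraMapInv t • a,
        I.add_mem (hI.mul_mem_left _ _ ha) (I.smul_mem _ ha), ?_⟩
      rw [map_mul, hra]
      change _ = (_ - _) * (a : Matrix (Fin L.size) (Fin L.size) k) +
        _ • (a : Matrix (Fin L.size) (Fin L.size) k)
      rw [sub_mul, Algebra.smul_def, sub_add_cancel])
    (by
      rintro r t ⟨hr, a, ha, hra⟩
      refine ⟨(augIdeal k g).mul_mem_right _ _ hr,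
        a * ⟨_, lift_sub_algebraMap_mem_adjoin L.coeff t⟩ + FreeAlgebra.algebraMapInv t • a,
        I.add_mem (hI.mul_mem_right _ _ ha) (I.smul_mem _ ha), ?_⟩
      rw [map_mul, hra]
      change _ = (a : Matrix (Fin L.size) (Fin L.size) k) * (_ - _) +
        _ • (a : Matrix (Fin L.size) (Fin L.size) k)
      rw [mul_sub, Algebra.smul_def, Algebra.commutes, sub_add_cancel])

theorem mem_coeffPreimage {L : MonicPencil k g} {I : Submodule k L.coeffAlgebra}
    {hI : IsTwoSidedAlgIdeal I} {r : FreeAlgebra k (Fin g)} :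
    r ∈ coeffPreimage L hI ↔
      r ∈ augIdeal k g ∧ ∃ a ∈ I, FreeAlgebra.lift k L.coeff r = a :=
  TwoSidedIdeal.mem_mk' _ _ _ _ _ _ _

theorem IsPointIdeal.isRegularMaximal_coeffImage {L : MonicPencil k g}
    {P : TwoSidedIdeal (FreeAlgebra k (Fin g))} (hP : IsPointIdeal P) (hLP : coeffIdeal L ≤ P) :
    IsRegularMaximal (coeffImage L P) := by
  refine ⟨isTwoSided_coeffImage L P, ?_, fun I hI hle => ?_⟩
  · by_contra! h
    refine (hP.isPrimeIdeal (augIdeal k g) (augIdeal k g) fun r hr t ht => ?_).elim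
      hP.not_augIdeal_le hP.not_augIdeal_le
    refine mem_of_lift_mem_coeffImage hLP
      (h ⟨_, lift_mem_adjoin L.coeff hr⟩ ⟨_, lift_mem_adjoin L.coeff ht⟩) ?_
    rw [map_mul]
    rfl
  · by_cases hc : coeffPreimage L hI ≤ P
    · refine Or.inl (le_antisymm (fun a ha => ?_) hle)
      obtain ⟨r, hr, hra⟩ := exists_lift_eq L a
      exact ⟨r, hc (mem_coeffPreimage.2 ⟨hr, a, ha, hra⟩), hr, hra⟩
    · right
      -- From `x + y = 1`, each `r` without constant term splits as `x r + y r`, whose values lie in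
      -- `I` and in the image of `P`.
      obtain ⟨x, hx, y, hy, hxy⟩ := TwoSidedIdeal.exists_add_eq_one_of_isCoatom hP.isCoatom hc
      rw [eq_top_iff]
      intro a _
      obtain ⟨r, hr, hra⟩ := exists_lift_eq L a
      obtain ⟨-, b, hb, hbx⟩ := mem_coeffPreimage.1 ((coeffPreimage L hI).mul_mem_right x r hx)
      have hc : (⟨_, lift_mem_adjoin L.coeff ((augIdeal k g).mul_mem_left y r hr)⟩ :
          L.coeffAlgebra) ∈ coeffImage L P :=
        ⟨y * r, P.mul_mem_right _ _ hy, (augIdeal k g).mul_mem_left _ _ hr, rfl⟩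
      have hsum := I.add_mem hb (hle hc)
      convert hsum using 1
      refine Subtype.ext ?_
      rw [← hra]
      change _ = (b : Matrix (Fin L.size) (Fin L.size) k) + FreeAlgebra.lift k L.coeff (y * r)
      rw [← hbx, ← map_add, ← add_mul, hxy, one_mul]

/-- The preimage `M` of `p` lies in the augmentation ideal, so it is too small to be a point ideal.
Enlarging it to the `r` with `x r y ∈ M` for all `x`, `y` without constant term adds no polynomial
without constant term, and the result is prime. -/
theorem exists_isPointIdeal_coeffImage_eq {L : MonicPencil k g}
    {p : Submodule k L.coeffAlgebra} (hp : IsRegularMaximal p) :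
    ∃ P, IsPointIdeal P ∧ coeffIdeal L ≤ P ∧ coeffImage L P = p := by
  set M := coeffPreimage L hp.isTwoSided with hM
  have hMp : ∀ {r} (a : L.coeffAlgebra), r ∈ M → FreeAlgebra.lift k L.coeff r = a → a ∈ p := by
    intro r a hr hra
    obtain ⟨-, b, hb, hrb⟩ := mem_coeffPreimage.1 hr
    rwa [Subtype.ext (hra.symm.trans hrb)]
  let P : TwoSidedIdeal (FreeAlgebra k (Fin g)) :=
    TwoSidedIdeal.mk' {r | ∀ x ∈ augIdeal k g, ∀ y ∈ augIdeal k g, x * r * y ∈ M}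
      (fun x _ y _ => by rw [mul_zero, zero_mul]; exact M.zero_mem)
      (fun hr ht x hx y hy => by
        rw [mul_add, add_mul]; exact M.add_mem (hr x hx y hy) (ht x hx y hy))
      (fun hr x hx y hy => by
        rw [mul_neg, neg_mul]; exact M.neg_mem (hr x hx y hy))
      (fun {t r} hr x hx y hy => by
        rw [← mul_assoc]; exact hr _ ((augIdeal k g).mul_mem_right _ _ hx) y hy)
      (fun {r t} hr x hx y hy => by
        rw [← mul_assoc, mul_assoc]; exact hr x hx _ ((augIdeal k g).mul_mem_left _ _ hy))
  have hP : ∀ r, r ∈ P ↔ ∀ x ∈ augIdeal k g, ∀ y ∈ augIdeal k g, x * r * y ∈ M := fun r =>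
    TwoSidedIdeal.mem_mk' _ _ _ _ _ _ _
  have hMP : M ≤ P := fun r hr => (hP r).2 fun x _ y _ =>
    M.mul_mem_right _ _ (M.mul_mem_left _ _ hr)
  have hPM : ∀ r ∈ P, r ∈ augIdeal k g → r ∈ M := by
    intro r hr hr'
    refine mem_coeffPreimage.2 ⟨hr', ⟨_, lift_mem_adjoin L.coeff hr'⟩, ?_, rfl⟩
    refine hp.mem_of_forall_mul_mem_left fun x => hp.mem_of_forall_mul_mem_right fun y => ?_
    obtain ⟨s, hs, hsx⟩ := exists_lift_eq L x
    obtain ⟨t, ht, hty⟩ := exists_lift_eq L y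
    refine hMp _ ((hP r).1 hr s hs t ht) ?_
    rw [map_mul, map_mul, hsx, hty]
    rfl
  have hLP : coeffIdeal L ≤ P := fun r hr => (hP r).2 fun x hx y _ =>
    mem_coeffPreimage.2 ⟨(augIdeal k g).mul_mem_right _ _ ((augIdeal k g).mul_mem_right _ _ hx),
      0, p.zero_mem, by rw [map_mul, map_mul, mem_coeffIdeal.1 hr, mul_zero, zero_mul]; rfl⟩
  have himage : coeffImage L P = p := by
    refine le_antisymm ?_ fun a ha => ?_
    · rintro a ⟨r, hr, hr', hra⟩
      exact hMp a (hPM r hr hr') hra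
    · obtain ⟨r, hr, hra⟩ := exists_lift_eq L a
      exact ⟨r, hMP (mem_coeffPreimage.2 ⟨hr, a, ha, hra⟩), hr, hra⟩
  have haug : ¬ augIdeal k g ≤ P := fun h => by
    refine hp.ne_top (top_le_iff.1 fun a _ => ?_)
    obtain ⟨r, hr, hra⟩ := exists_lift_eq L a
    exact hMp a (hPM r (h hr) hr) hra
  have hcof := (cofinite_coeffIdeal L).mono hLP
  have hnle : ∀ I : TwoSidedIdeal (FreeAlgebra k (Fin g)), ¬ I ≤ P → ¬ coeffImage L I ≤ p := by
    intro I hI hle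
    refine hI fun r hr => (hP r).2 fun x hx y _ => ?_
    have hmem : x * r * y ∈ augIdeal k g :=
      (augIdeal k g).mul_mem_right _ _ ((augIdeal k g).mul_mem_right _ _ hx)
    exact mem_coeffPreimage.2 ⟨hmem, ⟨_, lift_mem_adjoin L.coeff hmem⟩,
      hle ⟨_, I.mul_mem_right _ _ (I.mul_mem_left _ _ hr), hmem, rfl⟩, rfl⟩
  have hprime : P.IsPrimeIdeal := by
    intro I J hIJ
    by_contra! hc
    refine (hp.le_or_le (isTwoSided_coeffImage L I) (isTwoSided_coeffImage L J) ?_).elim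
      (hnle I hc.1) (hnle J hc.2)
    rintro a ⟨r, hr, hr', hra⟩ b ⟨t, ht, -, htb⟩
    refine hMp _ (hPM _ (hIJ r hr t ht) ((augIdeal k g).mul_mem_right _ _ hr')) ?_
    rw [map_mul, hra, htb]
    rfl
  exact ⟨P, ⟨hcof, hcof.isCoatom_of_isPrimeIdeal hprime fun h => haug (h ▸ le_top),
    fun h => haug h.ge⟩, hLP, himage⟩

theorem encard_isPointIdeal (L : MonicPencil k g) :
    {P | IsPointIdeal P ∧ coeffIdeal L ≤ P}.encard =
      {p : Submodule k L.coeffAlgebra | IsRegularMaximal p}.encard := by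
  have himage : coeffImage L '' {P | IsPointIdeal P ∧ coeffIdeal L ≤ P} =
      {p : Submodule k L.coeffAlgebra | IsRegularMaximal p} := by
    ext p
    constructor
    · rintro ⟨P, ⟨hP, hLP⟩, rfl⟩
      exact hP.isRegularMaximal_coeffImage hLP
    · intro hp
      obtain ⟨P, hP, hLP, rfl⟩ := exists_isPointIdeal_coeffImage_eq hp
      exact ⟨P, ⟨hP, hLP⟩, rfl⟩
  rw [← himage]
  refine (Set.InjOn.encard_image ?_).symm
  rintro P ⟨hP, hLP⟩ Q ⟨hQ, hLQ⟩ h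
  -- Equal images give `P * augIdeal ⊆ Q`; since `Q` is prime and does not contain the augmentation
  -- ideal, `P ≤ Q`.
  refine hP.eq_of_le hQ ((hQ.isPrimeIdeal P (augIdeal k g) fun a ha b hb => ?_).resolve_right
    hQ.not_augIdeal_le)
  have hab : a * b ∈ augIdeal k g := (augIdeal k g).mul_mem_left _ _ hb
  have hmem : (⟨_, lift_mem_adjoin L.coeff hab⟩ : L.coeffAlgebra) ∈ coeffImage L P :=
    ⟨a * b, P.mul_mem_right _ _ ha, hab, rfl⟩
  exact mem_of_lift_mem_coeffImage hLQ (h ▸ hmem) rfl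

/-- The image of the kernel of evaluation is zero, so the zero ideal of the coefficient algebra is
regular maximal. -/
theorem isSimpleAlg_of_isPointIdeal {L : MonicPencil k g} (hL : IsPointIdeal (coeffIdeal L)) :
    IsSimpleAlg k L.coeffAlgebra := by
  have hbot : coeffImage L (coeffIdeal L) = ⊥ := by
    rw [eq_bot_iff]
    rintro a ⟨r, hr, -, hra⟩
    refine (Submodule.mem_bot k).2 (Subtype.ext ?_)
    rw [← hra, mem_coeffIdeal.1 hr]
    rfl
  rw [← isRegularMaximal_bot_iff, ← hbot]
  exact hL.isRegularMaximal_coeffImage le_rfl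

end FreeLocus

theorem proposition3p10 {k : Type u} [Field k] [CharZero k] (g : ℕ) :
    (∀ (L : MonicPencil k g) (s : ℕ) (B : Fin s → Type v)
        [∀ j, NonUnitalRing (B j)] [∀ j, Module k (B j)]
        [∀ j, IsScalarTower k (B j) (B j)] [∀ j, SMulCommClass k (B j) (B j)],
        (∀ j, IsSimpleAlg k (B j)) →
        (∃ φ : RadQuotient k L.coeffAlgebra →ₙₐ[k] (∀ j, B j), Function.Bijective φ) →
        (freeLocusComponents L.freeLocus).encard = s ∧
          ⋃₀ freeLocusComponents L.freeLocus = L.freeLocus) ∧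
    (∀ Z : Set (MatrixTuple k g), IsIrreducibleFreeLocus Z →
        ∃ L : MonicPencil k g, L.IsIrreducible ∧ L.freeLocus = Z) := by
  refine ⟨fun L s B _ _ _ _ hB hφ => ?_, fun Z hZ => ?_⟩
  · obtain ⟨φ, hφ⟩ := hφ
    rw [FreeLocus.freeLocus_eq_locus]
    refine ⟨?_, ?_⟩
    · rw [FreeLocus.encard_freeLocusComponents_locus, FreeLocus.encard_isPointIdeal,
        encard_isRegularMaximal hB φ hφ]
    · rw [FreeLocus.freeLocusComponents_locus]
      exact (FreeLocus.locus_eq_sUnion (FreeLocus.cofinite_coeffIdeal L)).symm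
  · obtain ⟨L, hmin, rfl⟩ := FreeLocus.exists_isMinimal hZ.1
    exact ⟨L, ⟨hmin, FreeLocus.isSimpleAlg_of_isPointIdeal
      (FreeLocus.isPointIdeal_coeffIdeal_of_isMinimal hmin hZ)⟩, rfl⟩
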